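/- Let $\mathcal{E}$ be a Grothendieck topos and let $\mathcal{A}$ be a class of objects of $\mathcal{E}$. A geometric morphism $\rho:\mathcal{F}\to\mathcal{E}$ is called $\mathcal{A}$-pure (resp. $\mathcal{A}$-dense) if for each $X$ in $\mathcal{A}$ the unit $X\to\rho_*\rho^*X$ is an isomorphism (resp. a monomorphism). A monomorphism $m:V\hookrightarrow U$ in $\mathcal{E}$ is called $\mathcal{A}$-pure (resp. $\mathcal{A}$-dense) if the associated geometric morphism $\mathcal{E}/V\to\mathcal{E}/U$, whose inverse image is pullback along $m$, is pure (resp. dense) for the class of objects $\pi_U^*X=(U\times X\to U)$ with $X$ in $\mathcal{A}$. For a Lawvere--Tierney topology $J$ on $\mathcal{E}$, let $\mathcal{E}_J\subseteq\mathcal{E}$ be the full subcategory of $J$-sheaves, i.e. of the objects $X$ such that $\mathrm{Hom}(U,X)\to\mathrm{Hom}(V,X)$ is bijective for every $J$-dense monomorphism $V\hookrightarrow U$. A subtopos of $\mathcal{E}$ is a full subcategory, closed under isomorphisms, whose inclusion functor has a left adjoint that preserves finite limits; it is called $\mathcal{A}$-pure or $\mathcal{A}$-dense if its inclusion, as a geometric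 morphism, is. **Theorem.** There is a unique Lawvere--Tierney topology $J$ on $\mathcal{E}$ whose $J$-dense monomorphisms are precisely the $\mathcal{A}$-pure (resp. $\mathcal{A}$-dense) monomorphisms. For this topology, $\mathcal{E}_J$ is a subtopos of $\mathcal{E}$, and it is the smallest $\mathcal{A}$-pure (resp. $\mathcal{A}$-dense) subtopos. More precisely, a subtopos $\mathcal{E}'\subseteq\mathcal{E}$ is $\mathcal{A}$-pure (resp. $\mathcal{A}$-dense) if and only if $\mathcal{E}_J\subseteq\mathcal{E}'$. Likewise, a geometric inclusion $i:\mathcal{E}'\to\mathcal{E}$ is $\mathcal{A}$-pure (resp. $\mathcal{A}$-dense) if and only if $\mathcal{E}_J$ is contained in the essential image of $i_*$. In particular, let $e:\mathcal{E}\to\mathcal{T}$ be a geometric morphism to a Grothendieck topos $\mathcal{T}$ with subobject classifier $\Omega_{\mathcal{T}}$. Call a subtopos $i:\mathcal{E}'\hookrightarrow\mathcal{E}$ dense over $\mathcal{T}$ if $e^*T\to i_*i^*e^*T$ is a monomorphism for each object $T$ of $\mathcal{T}$, and pure over $\mathcal{T}$ if $e^*\Omega_{\mathcal{T}}\to i_*i^*e^*\Omega_{\mathcal{T}}$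 is an isomorphism. For $\mathcal{A}=\{e^*T : T\in\mathcal{T}\}$ and the $\mathcal{A}$-dense monomorphisms, $\mathcal{E}_J$ is the smallest subtopos that is dense over $\mathcal{T}$; for $\mathcal{A}=\{e^*\Omega_{\mathcal{T}}\}$ and the $\mathcal{A}$-pure monomorphisms, $\mathcal{E}_J$ is the smallest subtopos that is pure over $\mathcal{T}$. In both cases a subtopos $\mathcal{E}'$ has the property if and only if $\mathcal{E}_J\subseteq\mathcal{E}'$. -/

import Mathlib

open CategoryTheory Limits Opposite

universe w v u u₁ v₁ u₂ v₂

/-! ### Dependent products in categories of sheaves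

These are needed to know that pulling back along a morphism of a Grothendieck topos has a right
adjoint, which is the direct image part of the geometric morphism between the slices. -/

namespace SheafPushforward
section
variable {C : Type w} [SmallCategory C] {V U W : Cᵒᵖ ⥤ Type w} (f : V ⟶ U) (p : W ⟶ V)

/-- For maps of presheaves `p : W ⟶ V` and `f : V ⟶ U`, a section over `c` of the dependent product
of `W` along `f`: a section `base` of `U` over `c` together with a section of `p` over the part
of `V` that lies above `base`. -/
structure Elt (c : C) where
  base : U.obj (op c)
  val : ∀ {d : C} (g : d ⟶ c) (x : V.obj (op d)),
    f.app (op d) x = U.map g.op base → W.obj (op d)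
  isOver : ∀ {d : C} (g : d ⟶ c) (x : V.obj (op d)) (h : f.app (op d) x = U.map g.op base),
    p.app (op d) (val g x h) = x
  nat : ∀ {d e : C} (k : e ⟶ d) (g : d ⟶ c) (x : V.obj (op d))
    (h : f.app (op d) x = U.map g.op base)
    (h' : f.app (op e) (V.map k.op x) = U.map (k ≫ g).op base),
    W.map k.op (val g x h) = val (k ≫ g) (V.map k.op x) h'

variable {f p}

theorem Elt.val_congr {c d : C} (s : Elt f p c) {g g' : d ⟶ c} {x x' : V.obj (op d)}
    (hg : g = g') (hx : x = x') (h : f.app (op d) x = U.map g.op s.base)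
    (h' : f.app (op d) x' = U.map g'.op s.base) : s.val g x h = s.val g' x' h' := by
  subst hg hx; rfl

theorem Elt.val_congr' {c d : C} {s t : Elt f p c} (e : s = t) {g : d ⟶ c} {x : V.obj (op d)}
    (h : f.app (op d) x = U.map g.op s.base)
    (h' : f.app (op d) x = U.map g.op t.base) : s.val g x h = t.val g x h' := by
  subst e; rfl

theorem Elt.ext' {c : C} {s t : Elt f p c} (hb : s.base = t.base)
    (hv : ∀ {d : C} (g : d ⟶ c) (x : V.obj (op d)) (h : f.app (op d) x = U.map g.op s.base)
      (h' : f.app (op d) x = U.map g.op t.base), s.val g x h = t.val g x h') : s = t := by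
  obtain ⟨b, a, _, _⟩ := s
  obtain ⟨b', a', _, _⟩ := t
  obtain rfl : b = b' := hb
  obtain rfl : @a = @a' := by
    funext d g x h
    exact hv g x h h
  rfl

def Elt.restrict {c c' : C} (e : c' ⟶ c) (s : Elt f p c) : Elt f p c' where
  base := U.map e.op s.base
  val g x h := s.val (g ≫ e) x (by simpa using h)
  isOver g x h := s.isOver _ _ _
  nat k g x h h' := by
    rw [s.nat k (g ≫ e) x _ (by simpa using h')]
    exact s.val_congr (by simp) rfl _ _

variable (f p) in
/-- The dependent product of `W` along `f`, as a presheaf. -/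
def presheaf : Cᵒᵖ ⥤ Type w where
  obj c := Elt f p c.unop
  map e := ↾(Elt.restrict e.unop)
  map_id c := by
    ext s
    refine Elt.ext' (by simp [Elt.restrict]) fun g x h h' ↦ ?_
    exact s.val_congr (by simp) rfl _ _
  map_comp e e' := by
    ext s
    refine Elt.ext' (by simp [Elt.restrict]) fun g x h h' ↦ ?_
    exact s.val_congr (by simp) rfl _ _

variable (f p) in
/-- The projection of the dependent product to `U`. -/
def proj : presheaf f p ⟶ U where
  app c := ↾(fun s ↦ s.base)

theorem isSheaf {K : GrothendieckTopology C} (hU : Presieve.IsSheaf K U)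
    (hV : Presieve.IsSheaf K V) (hW : Presieve.IsSheaf K W) :
    Presieve.IsSheaf K (presheaf f p) := by
  intro c S hS s hs
  rw [Presieve.compatible_iff_sieveCompatible] at hs
  obtain ⟨σ, hσ⟩ : ∃ σ : ∀ {d : C} (g : d ⟶ c), S g → Elt f p d,
      ∀ {d : C} (g : d ⟶ c) (hg : S g), σ g hg = s g hg := ⟨fun g hg ↦ s g hg, fun _ _ ↦ rfl⟩
  have hs' : ∀ {d e : C} (g : d ⟶ c) (hg : S g) (k : e ⟶ d),
      σ (k ≫ g) (S.downward_closed hg k) = (σ g hg).restrict k := by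
    intro d e g hg k
    rw [hσ, hσ]
    exact hs g k hg
  have hc : ∀ {d : C} {g g' : d ⟶ c} (hg : S g) (hg' : S g'), g = g' → σ g hg = σ g' hg' := by
    rintro d g _ hg hg' rfl
    rfl
  let b : Presieve.FamilyOfElements U S.arrows := fun d g hg ↦ (σ g hg).base
  have hb : b.Compatible := by
    rw [Presieve.compatible_iff_sieveCompatible]
    intro d e g k hg
    change (σ (k ≫ g) _).base = _
    rw [hs' g hg k]; rfl
  let u := (hU S hS).amalgamate b hb
  have hu : ∀ {d : C} (g : d ⟶ c) (hg : S g), U.map g.op u = (σ g hg).base :=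
    fun g hg ↦ (hU S hS).valid_glue hb g hg
  have key : ∀ {d : C} (g : d ⟶ c) (x : V.obj (op d)), f.app (op d) x = U.map g.op u →
      ∃ y : W.obj (op d), ∀ {e : C} (k : e ⟶ d) (hk : S (k ≫ g))
        (h : f.app (op e) (V.map k.op x) = U.map (𝟙 e : e ⟶ e).op (σ (k ≫ g) hk).base),
        W.map k.op y = (σ (k ≫ g) hk).val (𝟙 e) (V.map k.op x) h := by
    intro d g x hx
    have hh : ∀ {e : C} (k : e ⟶ d) (hk : S (k ≫ g)),
        f.app (op e) (V.map k.op x) = U.map (𝟙 e : e ⟶ e).op (σ (k ≫ g) hk).base := by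
      intro e k hk
      rw [← hu _ hk, NatTrans.naturality_apply, hx]
      simp
    let a : Presieve.FamilyOfElements W (S.pullback g).arrows := fun e k hk ↦
      (σ (k ≫ g) hk).val (𝟙 e) (V.map k.op x) (hh k hk)
    have ha : a.Compatible := by
      rw [Presieve.compatible_iff_sieveCompatible]
      intro e e' k l hk
      change (σ ((l ≫ k) ≫ g) _).val (𝟙 e') (V.map (l ≫ k).op x) _ =
        W.map l.op ((σ (k ≫ g) hk).val (𝟙 e) (V.map k.op x) _)
      have e1 : f.app (op e') (V.map l.op (V.map k.op x)) =
          U.map (l ≫ 𝟙 e).op (σ (k ≫ g) hk).base := by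
        rw [NatTrans.naturality_apply, hh k hk]; simp
      rw [(σ (k ≫ g) hk).nat l (𝟙 e) (V.map k.op x) (hh k hk) e1]
      have e2 : σ ((l ≫ k) ≫ g) (by simpa using S.downward_closed hk l) =
          (σ (k ≫ g) hk).restrict l := by
        rw [← hs' (k ≫ g) hk l]
        exact hc _ _ (by simp)
      rw [Elt.val_congr' e2 _ (by rw [← e2]; exact hh (l ≫ k) _)]
      exact Elt.val_congr (σ (k ≫ g) hk) (g := 𝟙 e' ≫ l) (by rw [Category.id_comp, Category.comp_id])
        (by rw [op_comp, Functor.map_comp_apply]) _ _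
    refine ⟨(hW _ (K.pullback_stable g hS)).amalgamate a ha, fun k hk h ↦ ?_⟩
    exact (hW _ (K.pullback_stable g hS)).valid_glue ha k hk
  choose y hy using @key
  have hf : ∀ {d e : C} (k : e ⟶ d) (g : d ⟶ c) (hk : S (k ≫ g)) (x : V.obj (op d)),
      f.app (op d) x = U.map g.op u →
      f.app (op e) (V.map k.op x) = U.map (𝟙 e : e ⟶ e).op (σ (k ≫ g) hk).base := by
    intro d e k g hk x hx
    rw [← hu _ hk, NatTrans.naturality_apply, hx]
    simp
  let t : Elt f p c :=
    { base := u
      val := fun g x h ↦ y g x h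
      isOver := by
        intro d g x h
        refine (hV _ (K.pullback_stable g hS)).isSeparatedFor.ext fun e k hk ↦ ?_
        rw [← NatTrans.naturality_apply, hy g x h k hk (hf k g hk x h), Elt.isOver]
      nat := by
        intro d e k g x h h'
        refine (hW _ (K.pullback_stable (k ≫ g) hS)).isSeparatedFor.ext fun e' l hl ↦ ?_
        rw [hy (k ≫ g) _ h' l hl (hf l _ hl _ h'), ← Functor.map_comp_apply, ← op_comp,
          hy g x h (l ≫ k) (by simpa using hl) (hf (l ≫ k) g (by simpa using hl) x h)]
        have e2 : σ ((l ≫ k) ≫ g) (by simpa using hl) = σ (l ≫ k ≫ g) hl := hc _ _ (by simp)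
        rw [Elt.val_congr' e2 _ (by rw [← e2]; exact hf (l ≫ k) g (by simpa using hl) x h)]
        exact Elt.val_congr _ rfl (by simp) _ _ }
  refine ⟨t, ?_, ?_⟩
  · intro d e he
    change t.restrict e = s e he
    rw [← hσ]
    refine Elt.ext' (hu e he) fun {d'} g x h h' ↦ ?_
    refine (hW _ (K.pullback_stable (g ≫ e) hS)).isSeparatedFor.ext fun e' l hl ↦ ?_
    have h0 : f.app (op d') x = U.map (g ≫ e).op u := by
      rw [h]; change U.map g.op (U.map e.op u) = _; simp
    change W.map l.op (y (g ≫ e) x h0) = _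
    rw [hy (g ≫ e) x h0 l hl (hf l _ hl x h0)]
    have e2 : σ (l ≫ g ≫ e) hl = (σ e he).restrict (l ≫ g) := by
      rw [← hs' e he]
      exact hc _ _ (by simp)
    rw [Elt.val_congr' e2 _ (by rw [← e2]; exact hf l _ hl x h0),
      (σ e he).nat l g x h' (by rw [NatTrans.naturality_apply, h']; simp)]
    exact Elt.val_congr (σ e he) (g := 𝟙 e' ≫ l ≫ g) (Category.id_comp _)
      rfl _ _
  · intro t' ht'
    have ht : ∀ {d : C} (e : d ⟶ c) (he : S e), Elt.restrict e t' = σ e he := fun e he ↦ (ht' e he).trans (hσ e he).symm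
    have hb' : Elt.base t' = u := by
      refine (hU S hS).isSeparatedFor.ext fun d e he ↦ ?_
      rw [hu e he, ← ht e he]; rfl
    refine Elt.ext' hb' fun {d} g x h h' ↦ ?_
    refine (hW _ (K.pullback_stable g hS)).isSeparatedFor.ext fun e' l hl ↦ ?_
    change _ = W.map l.op (y g x h')
    rw [hy g x h' l hl (hf l g hl x h'), ← Elt.val_congr' (ht (l ≫ g) hl)
      (by rw [ht]; exact hf l g hl x h')]
    rw [Elt.nat t' l g x h (by rw [NatTrans.naturality_apply, h]; simp)]
    exact Elt.val_congr _ (by simp) rfl _ _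


section
variable {X Y : Cᵒᵖ ⥤ Type w} {a : X ⟶ Y} {b : X ⟶ V} {q : Y ⟶ U}

theorem exists_lift (sq : IsPullback a b q f) {c : C} (y : Y.obj (op c)) (x : V.obj (op c))
    (h : q.app (op c) y = f.app (op c) x) :
    ∃ z : X.obj (op c), a.app (op c) z = y ∧ b.app (op c) z = x :=
  ((Types.isPullback_iff _ _ _ _).1 (IsPullback.iff_app.1 sq (op c))).2.2 y x h

noncomputable def lift (sq : IsPullback a b q f) {c : C} (y : Y.obj (op c)) (x : V.obj (op c))
    (h : q.app (op c) y = f.app (op c) x) : X.obj (op c) := (exists_lift sq y x h).choose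

theorem lift_fst (sq : IsPullback a b q f) {c : C} (y : Y.obj (op c)) (x : V.obj (op c))
    (h : q.app (op c) y = f.app (op c) x) : a.app (op c) (lift sq y x h) = y :=
  (exists_lift sq y x h).choose_spec.1

theorem lift_snd (sq : IsPullback a b q f) {c : C} (y : Y.obj (op c)) (x : V.obj (op c))
    (h : q.app (op c) y = f.app (op c) x) : b.app (op c) (lift sq y x h) = x :=
  (exists_lift sq y x h).choose_spec.2

theorem lift_ext (sq : IsPullback a b q f) {c : C} {z z' : X.obj (op c)}
    (h : a.app (op c) z = a.app (op c) z') (h' : b.app (op c) z = b.app (op c) z') : z = z' :=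
  ((Types.isPullback_iff _ _ _ _).1 (IsPullback.iff_app.1 sq (op c))).2.1 z z' ⟨h, h'⟩

theorem sq_app (sq : IsPullback a b q f) {c : C} (z : X.obj (op c)) :
    q.app (op c) (a.app (op c) z) = f.app (op c) (b.app (op c) z) :=
  congr($(NatTrans.congr_app sq.w (op c)) z)

noncomputable def curryElt (sq : IsPullback a b q f) (β : X ⟶ W) (hβ : β ≫ p = b) {c : C}
    (y : Y.obj (op c)) : Elt f p c where
  base := q.app (op c) y
  val {d} g x h := β.app (op d) (lift sq (Y.map g.op y) x (by rw [NatTrans.naturality_apply, h]))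
  isOver {d} g x h := by
    have := congr($(NatTrans.congr_app hβ (op d)) (lift sq (Y.map g.op y) x
      (by rw [NatTrans.naturality_apply, h])))
    refine Eq.trans this (lift_snd _ _ _ _)
  nat {d e} k g x h h' := by
    rw [← NatTrans.naturality_apply]
    congr 1
    apply lift_ext sq
    · rw [NatTrans.naturality_apply, lift_fst, lift_fst]; simp
    · rw [NatTrans.naturality_apply, lift_snd, lift_snd]

noncomputable def curry (sq : IsPullback a b q f) (β : X ⟶ W) (hβ : β ≫ p = b) :
    Y ⟶ presheaf f p where
  app c := ↾(curryElt sq β hβ)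
  naturality c d g := by
    ext y
    refine Elt.ext' (show q.app d (Y.map g y) = U.map g (q.app c y) from
      NatTrans.naturality_apply q g y) fun {e} k x h h' ↦ ?_
    change β.app (op e) _ = β.app (op e) _
    congr 1
    apply lift_ext sq
    · rw [lift_fst, lift_fst]
      change Y.map k.op (Y.map g y) = Y.map (k ≫ g.unop).op y
      simp
    · rw [lift_snd, lift_snd]

theorem curry_proj (sq : IsPullback a b q f) (β : X ⟶ W) (hβ : β ≫ p = b) :
    curry sq β hβ ≫ proj f p = q := rfl

def ev (α : Y ⟶ presheaf f p) {c : C} (y : Y.obj (op c)) : Elt f p c := α.app (op c) y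

theorem proj_app (α : Y ⟶ presheaf f p) (hα : α ≫ proj f p = q) {c : C} (y : Y.obj (op c)) :
    (ev α y).base = q.app (op c) y :=
  congr($(NatTrans.congr_app hα (op c)) y)

theorem uncurry_aux (sq : IsPullback a b q f) (α : Y ⟶ presheaf f p) (hα : α ≫ proj f p = q)
    {c : C} (z : X.obj (op c)) : f.app (op c) (b.app (op c) z) =
      U.map (𝟙 c : c ⟶ c).op ((ev α (a.app (op c) z)).base) := by
  rw [proj_app α hα, ← sq_app sq]; simp

theorem app_restrict (α : Y ⟶ presheaf f p) {c d : C} (g : d ⟶ c) (y : Y.obj (op c)) :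
    ev α (Y.map g.op y) = (ev α y).restrict g :=
  NatTrans.naturality_apply α g.op y

def uncurry (sq : IsPullback a b q f) (α : Y ⟶ presheaf f p) (hα : α ≫ proj f p = q) : X ⟶ W where
  app c := ↾(fun z ↦ (ev α (a.app (op c.unop) z)).val (𝟙 c.unop)
    (b.app (op c.unop) z) (uncurry_aux sq α hα z))
  naturality c d g := by
    ext z
    obtain ⟨c⟩ := c
    obtain ⟨d⟩ := d
    obtain ⟨g, rfl⟩ : ∃ k : d ⟶ c, g = k.op := ⟨g.unop, rfl⟩
    change (ev α (a.app (op d) (X.map g.op z))).val (𝟙 d) (b.app (op d) (X.map g.op z)) _ =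
      W.map g.op ((ev α (a.app (op c) z)).val (𝟙 c) (b.app (op c) z) _)
    rw [Elt.nat _ g (𝟙 c) _ _ (by
      rw [NatTrans.naturality_apply, uncurry_aux sq α hα z, ← Functor.map_comp_apply]; rfl)]
    rw [Elt.val_congr' (t := (ev α (a.app (op c) z)).restrict g)
      (by rw [NatTrans.naturality_apply]; exact app_restrict α g _) _ (by
        rw [NatTrans.naturality_apply, NatTrans.naturality_apply, uncurry_aux sq α hα z]
        simp [Elt.restrict])]
    exact Elt.val_congr (ev α (a.app (op c) z)) (g := 𝟙 d ≫ g)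
      (by rw [Category.id_comp, Category.comp_id]) (NatTrans.naturality_apply b _ _) _ _

theorem uncurry_comp (sq : IsPullback a b q f) (α : Y ⟶ presheaf f p) (hα : α ≫ proj f p = q) :
    uncurry sq α hα ≫ p = b := by
  ext c z
  exact Elt.isOver _ _ _ _

theorem uncurry_curry (sq : IsPullback a b q f) (β : X ⟶ W) (hβ : β ≫ p = b) :
    uncurry sq (curry sq β hβ) (curry_proj sq β hβ) = β := by
  ext c z
  change β.app c (lift sq (Y.map (𝟙 c.unop).op (a.app c z)) (b.app c z) _) = β.app c z
  congr 1
  apply lift_ext sq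
  · rw [lift_fst]; simp
  · rw [lift_snd]

theorem curry_uncurry (sq : IsPullback a b q f) (α : Y ⟶ presheaf f p) (hα : α ≫ proj f p = q) :
    curry sq (uncurry sq α hα) (uncurry_comp sq α hα) = α := by
  ext c y
  obtain ⟨c⟩ := c
  refine Elt.ext' (proj_app α hα y).symm fun {d} g x h h' ↦ ?_
  have hq : q.app (op d) (Y.map g.op y) = f.app (op d) x := by
    rw [NatTrans.naturality_apply]; exact h.symm
  change (ev α (a.app (op d) (lift sq (Y.map g.op y) x hq))).val (𝟙 d)
    (b.app (op d) (lift sq (Y.map g.op y) x hq)) _ = (ev α y).val g x h'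
  have h'' : f.app (op d) x = U.map g.op (ev α y).base := h'
  rw [Elt.val_congr' (t := (ev α y).restrict g)
    (by rw [lift_fst]; exact app_restrict α g _) _ (by
      rw [lift_snd]; simpa [Elt.restrict] using h'')]
  exact Elt.val_congr (ev α y) (g := 𝟙 d ≫ g) (Category.id_comp _) (lift_snd _ _ _ _) _ _

theorem curry_naturality {X' Y' : Cᵒᵖ ⥤ Type w} {a' : X' ⟶ Y'} {b' : X' ⟶ V} {q' : Y' ⟶ U}
    (sq : IsPullback a b q f) (sq' : IsPullback a' b' q' f) (k : X' ⟶ X) (l : Y' ⟶ Y)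
    (h₁ : k ≫ a = a' ≫ l) (h₂ : k ≫ b = b') (h₃ : l ≫ q = q')
    (β : X ⟶ W) (hβ : β ≫ p = b) (hβ' : (k ≫ β) ≫ p = b') :
    curry sq' (k ≫ β) hβ' = l ≫ curry sq β hβ := by
  ext c y
  obtain ⟨c⟩ := c
  refine Elt.ext' congr($(NatTrans.congr_app h₃.symm (op c)) y) fun {d} g x h h' ↦ ?_
  change β.app (op d) (k.app (op d) (lift sq' _ x _)) = β.app (op d) (lift sq _ x _)
  congr 1
  apply lift_ext sq
  · rw [lift_fst]
    refine Eq.trans congr($(NatTrans.congr_app h₁ (op d)) _) ?_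
    change l.app (op d) (a'.app (op d) _) = Y.map g.op (l.app (op c) y)
    rw [lift_fst, NatTrans.naturality_apply]
  · rw [lift_snd]
    refine Eq.trans congr($(NatTrans.congr_app h₂ (op d)) _) ?_
    rw [lift_snd]
end

end

section
variable {C : Type w} [SmallCategory C] {K : GrothendieckTopology C} {V U : Sheaf K (Type w)}
  (f : V ⟶ U)

/-- The dependent product of the sheaf `W` over `V` along `f : V ⟶ U`, as a sheaf over `U`. -/
def obj (W : Over V) : Over U :=
  Over.mk (Y := (⟨presheaf f.hom W.hom.hom, (isSheaf_iff_isSheaf_of_type _ _).2 (isSheaf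
    ((isSheaf_iff_isSheaf_of_type _ _).1 U.2) ((isSheaf_iff_isSheaf_of_type _ _).1 V.2)
    ((isSheaf_iff_isSheaf_of_type _ _).1 W.left.2))⟩ : Sheaf K (Type w))) ⟨proj f.hom W.hom.hom⟩

theorem square (Y : Over U) :
    IsPullback (pullback.fst Y.hom f).hom (pullback.snd Y.hom f).hom Y.hom.hom f.hom :=
  (IsPullback.of_hasPullback Y.hom f).map (sheafToPresheaf K (Type w))

/-- Pulling back along `f` is left adjoint to the dependent product along `f`. -/
noncomputable def homEquiv (Y : Over U) (W : Over V) :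
    ((Over.pullback f).obj Y ⟶ W) ≃ (Y ⟶ obj f W) where
  toFun β := Over.homMk ⟨curry (square f Y) β.left.hom congr($(Over.w β).hom)⟩
  invFun α := Over.homMk ⟨uncurry (square f Y) α.left.hom congr($(Over.w α).hom)⟩
    (by ext1; exact uncurry_comp (square f Y) α.left.hom congr($(Over.w α).hom))
  left_inv β := by
    ext1; ext1
    exact uncurry_curry (square f Y) β.left.hom congr($(Over.w β).hom)
  right_inv α := by
    ext1; ext1
    exact curry_uncurry (square f Y) α.left.hom congr($(Over.w α).hom)

theorem isLeftAdjoint_pullback : (Over.pullback f).IsLeftAdjoint := by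
  refine (Adjunction.adjunctionOfEquivRight (homEquiv f) ?_).isLeftAdjoint
  intro Y' Y W k β
  ext1; ext1
  refine curry_naturality (square f Y) (square f Y') ((Over.pullback f).map k).left.hom k.left.hom
    ?_ ?_ ?_ β.left.hom congr($(Over.w β).hom) _
  · have : ((Over.pullback f).map k).left ≫ pullback.fst Y.hom f =
      pullback.fst Y'.hom f ≫ k.left := pullback.lift_fst _ _ _
    exact congr($(this).hom)
  · exact congr($(Over.w ((Over.pullback f).map k)).hom)
  · exact congr($(Over.w k).hom)
end
end SheafPushforward

/-! ### Grothendieck toposes -/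

/-- A Grothendieck topos is a category that is equivalent to the category of sheaves of sets on
a small site. -/
class IsGrothendieckTopos (E : Type u) [Category.{v} E] : Prop where
  exists_equivalence : ∃ (C : Type v) (_ : SmallCategory C) (K : GrothendieckTopology C),
    Nonempty (E ≌ Sheaf K (Type v))

namespace IsGrothendieckTopos

variable (E : Type u) [Category.{v} E] [IsGrothendieckTopos E]

instance : HasFiniteLimits E := by
  obtain ⟨C, _, K, ⟨e⟩⟩ := exists_equivalence (E := E)
  exact ⟨fun J _ _ ↦ Adjunction.hasLimitsOfShape_of_equivalence e.functor⟩

instance : HasSubobjectClassifier E := by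
  obtain ⟨C, _, K, ⟨e⟩⟩ := exists_equivalence (E := E)
  exact ⟨⟨(Sheaf.classifier K).ofEquivalence e.symm⟩⟩

variable {E}

instance isLeftAdjoint_pullback {V U : E} (f : V ⟶ U) : (Over.pullback f).IsLeftAdjoint := by
  obtain ⟨C, _, K, ⟨e⟩⟩ := exists_equivalence (E := E)
  have := SheafPushforward.isLeftAdjoint_pullback (e.functor.map f)
  let adj := (Over.postEquiv V e).toAdjunction.comp
    ((Over.mapPullbackAdj (e.functor.map f)).comp (Over.postEquiv U e).symm.toAdjunction)
  let i : (Over.postEquiv V e).functor ⋙ Over.map (e.functor.map f) ⋙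
      (Over.postEquiv U e).inverse ≅ Over.map f :=
    (Functor.isoWhiskerRight (NatIso.ofComponents (fun X ↦ Over.isoMk (Iso.refl _) (by
      change 𝟙 _ ≫ e.functor.map (X.hom ≫ f) = e.functor.map X.hom ≫ e.functor.map f
      simp)) :
      (Over.postEquiv V e).functor ⋙ Over.map (e.functor.map f) ≅
        Over.map f ⋙ (Over.postEquiv U e).functor) (Over.postEquiv U e).inverse) ≪≫
      Functor.isoWhiskerLeft (Over.map f) (Over.postEquiv U e).unitIso.symm
  have h : ((Over.postEquiv U e).functor ⋙ Over.pullback (e.functor.map f)) ⋙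
      (Over.postEquiv V e).inverse ≅ Over.pullback f :=
    ((adj.ofNatIsoLeft i).rightAdjointUniq (Over.mapPullbackAdj f))
  exact Functor.isLeftAdjoint_of_iso h

end IsGrothendieckTopos

/-! ### Geometric morphisms -/

/-- A geometric morphism `F ⟶ E`: a direct image functor with a left adjoint (the inverse image)
that preserves finite limits. -/
structure GeometricMorphism (F : Type u₁) [Category.{v₁} F] (E : Type u) [Category.{v} E] where
  /-- The direct image functor. -/
  direct : F ⥤ E
  /-- The inverse image functor. -/
  inverse : E ⥤ F
  /-- The inverse image is left adjoint to the direct image. -/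
  adj : inverse ⊣ direct
  /-- The inverse image preserves finite limits. -/
  lex : PreservesFiniteLimits inverse

namespace GeometricMorphism

variable {E : Type u} [Category.{v} E] {F : Type u₁} [Category.{v₁} F]

/-- A geometric morphism is an inclusion if its direct image is fully faithful. -/
structure IsInclusion (ρ : GeometricMorphism F E) : Prop where
  full : ρ.direct.Full
  faithful : ρ.direct.Faithful

/-- For a class of objects `A`, the geometric morphism `ρ` is `A`-pure if the unit
`X ⟶ ρ_* ρ^* X` is an isomorphism for all `X` in `A`. -/
def IsPure (ρ : GeometricMorphism F E) (A : ObjectProperty E) : Prop :=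
  ∀ X, A X → IsIso (ρ.adj.unit.app X)

/-- For a class of objects `A`, the geometric morphism `ρ` is `A`-dense if the unit
`X ⟶ ρ_* ρ^* X` is a monomorphism for all `X` in `A`. -/
def IsDense (ρ : GeometricMorphism F E) (A : ObjectProperty E) : Prop :=
  ∀ X, A X → Mono (ρ.adj.unit.app X)

variable {T : Type u₂} [Category.{v₂} T]

/-- For `e : E ⟶ T`, the geometric morphism `ρ : F ⟶ E` is dense over the base `T` if the unit
`e^* X ⟶ ρ_* ρ^* e^* X` is a monomorphism for all objects `X` of `T`. -/
def IsDenseOver (ρ : GeometricMorphism F E) (e : GeometricMorphism E T) : Prop :=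
  ∀ X : T, Mono (ρ.adj.unit.app (e.inverse.obj X))

/-- For `e : E ⟶ T`, the geometric morphism `ρ : F ⟶ E` is pure over the base `T` if the unit
`e^* Ω ⟶ ρ_* ρ^* e^* Ω` is an isomorphism, with `Ω` the subobject classifier of `T`. -/
def IsPureOver [HasSubobjectClassifier T] (ρ : GeometricMorphism F E)
    (e : GeometricMorphism E T) : Prop :=
  IsIso (ρ.adj.unit.app (e.inverse.obj (HasSubobjectClassifier.Ω T)))

/-- The class of all objects `e^* X` that are constant over the base `T`. -/
def constants (e : GeometricMorphism E T) : ObjectProperty E :=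
  (⊤ : ObjectProperty T).strictMap e.inverse

/-- The class with the single object `e^* Ω`, with `Ω` the subobject classifier of the base `T`. -/
def constantOmega [HasSubobjectClassifier T] (e : GeometricMorphism E T) : ObjectProperty E :=
  ObjectProperty.singleton (e.inverse.obj (HasSubobjectClassifier.Ω T))

end GeometricMorphism

section Slices

variable {E : Type u} [Category.{v} E] [IsGrothendieckTopos E]

/-- The geometric morphism `E/V ⟶ E/U` associated to `f : V ⟶ U`; its inverse image is pulling
back along `f`. -/
noncomputable def sliceMorphism {V U : E} (f : V ⟶ U) :
    GeometricMorphism (Over V) (Over U) where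
  direct := (Over.pullback f).rightAdjoint
  inverse := Over.pullback f
  adj := Adjunction.ofIsLeftAdjoint (Over.pullback f)
  lex := inferInstance

/-- The class of objects `π_U^* X = (U × X ⟶ U)` of `E/U`, with `X` in `A`. -/
noncomputable def restrictToSlice (A : ObjectProperty E) (U : E) : ObjectProperty (Over U) :=
  A.strictMap (Over.star U)

/-- The `A`-pure monomorphisms `V ⟶ U` of `E`: those for which the associated geometric morphism
`E/V ⟶ E/U` is pure for (the restriction to `E/U` of) the class `A`. -/
def pureMonos (A : ObjectProperty E) : MorphismProperty E := fun _ U m ↦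
  Mono m ∧ (sliceMorphism m).IsPure (restrictToSlice A U)

/-- The `A`-dense monomorphisms `V ⟶ U` of `E`: those for which the associated geometric morphism
`E/V ⟶ E/U` is dense for (the restriction to `E/U` of) the class `A`. -/
def denseMonos (A : ObjectProperty E) : MorphismProperty E := fun _ U m ↦
  Mono m ∧ (sliceMorphism m).IsDense (restrictToSlice A U)

end Slices

/-! ### Lawvere–Tierney topologies -/

section Topologies

open HasSubobjectClassifier

variable (E : Type u) [Category.{v} E] [HasFiniteLimits E] [HasSubobjectClassifier E]

/-- The internal meet `∧ : Ω × Ω ⟶ Ω`, classifying `(true, true)`. -/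
noncomputable def omegaMeet : Limits.prod (Ω E) (Ω E) ⟶ Ω E :=
  χ (prod.lift (truth E) (truth E))

/-- A Lawvere–Tierney topology on `E`. -/
@[ext]
structure LawvereTierneyTopology where
  /-- The closure operator on `Ω`. -/
  j : Ω E ⟶ Ω E
  truth_j : truth E ≫ j = truth E
  j_j : j ≫ j = j
  meet_j : omegaMeet E ≫ j = prod.map j j ≫ omegaMeet E

namespace LawvereTierneyTopology

variable {E} (J : LawvereTierneyTopology E)

/-- The `J`-dense monomorphisms: those `m : V ⟶ U` for which the closure of the subobject `m`,
classified by `χ m ≫ j`, is the maximal subobject of `U`. -/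
def denseMonos : MorphismProperty E := fun _ U m ↦
  ∃ _ : Mono m, χ m ≫ J.j = χ (𝟙 U)

/-- The `J`-sheaves: the objects `X` such that restriction `Hom(U, X) → Hom(V, X)` is bijective
for each `J`-dense monomorphism `V ⟶ U`. -/
def sheaves : ObjectProperty E := fun X ↦
  ∀ ⦃V U : E⦄ (m : V ⟶ U), J.denseMonos m → Function.Bijective (fun g : U ⟶ X ↦ m ≫ g)

end LawvereTierneyTopology

end Topologies

/-! ### Subtoposes -/

/-- A subtopos of a topos `E`, as a replete full subcategory whose inclusion functor has a left
adjoint that preserves finite limits. -/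
@[ext]
structure Subtopos (E : Type u) [Category.{v} E] where
  /-- The objects of the subtopos. -/
  obj : ObjectProperty E
  closedUnderIso : obj.IsClosedUnderIsomorphisms
  isRightAdjoint : obj.ι.IsRightAdjoint
  lex : PreservesFiniteLimits obj.ι.leftAdjoint

namespace Subtopos

variable {E : Type u} [Category.{v} E]

/-- Subtoposes are ordered by inclusion. -/
instance : PartialOrder (Subtopos E) := PartialOrder.lift obj fun _ _ ↦ Subtopos.ext

/-- The inclusion of a subtopos, as a geometric morphism. -/
noncomputable def inclusion (S : Subtopos E) : GeometricMorphism S.obj.FullSubcategory E :=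
  have := S.isRightAdjoint
  { direct := S.obj.ι
    inverse := S.obj.ι.leftAdjoint
    adj := Adjunction.ofIsRightAdjoint S.obj.ι
    lex := S.lex }

end Subtopos

/-! Transposing through the adjunctions `Over.forget U ⊣ Over.star U`, `Over.map m ⊣ Over.pullback
m` and `Over.pullback m ⊣ R` turns composition with the unit at `π_U^* X` into restriction along
pullbacks of `m`. By Yoneda, `m : V ⟶ U` is pure (dense) iff `Hom(W, X) → Hom(W ×_U V, X)` is
bijective (injective) for all `W ⟶ U` and `X` in `A` (`pureMonos_eq`, `denseMonos_eq`). Stability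
under pullback and composition, and upward closure, are then formal.

Such a class is classified by an endomorphism of `Ω`. Over any base there is a largest subobject on
which a given morphism is mono or iso, built from dependent products. For the unit that belongs to
`truth` and `X`, this is a subobject of `Ω`, whose classifying map handles `X`. The conditions for
the various `X` are intersected. The closure properties make the result a topology
(`exists_denseMonos_eq`), unique because its dense monos determine `j`.

On a site, the `J`-sheaves are the sheaves for the finest topology that makes them all sheaves,
since dense monos become local isomorphisms there. Sheafification gives the left exact reflection.

For an inclusion `i`, the image of `i_*` consists of the objects local for the monos inverted by
`i^*` (`IsInclusion.mem_essImage`). If `i` is pure or dense, these monos are `J`-dense, so the image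
contains all `J`-sheaves. Conversely, suppose that it does. In the pure case the members of `A` are
`J`-sheaves, so their units are invertible. In the dense case the diagonal of the kernel pair of the
unit at `X` is inverted by `i^*`, hence seen as invertible by all `J`-sheaves, hence `J`-dense; `X`
is separated for it, so the unit is mono. -/

/-! ### Truth values at a stage -/

namespace TruthValue

open HasSubobjectClassifier

variable {E : Type u} [Category.{v} E] [HasSubobjectClassifier E]

/-- The truth value `true` at the stage `U`. -/
noncomputable def top (U : E) : U ⟶ Ω E := χ (𝟙 U)

theorem eq_top {U : E} (a : U ⟶ Ω₀ E) : a ≫ truth E = top U := by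
  have h := (isPullback_χ (𝟙 U)).w
  rw [Category.id_comp] at h
  rw [top, h]
  congr 1
  exact Subsingleton.elim _ _

theorem comp_top {W U : E} (h : W ⟶ U) : h ≫ top U = top W := by
  rw [← eq_top (Subobject.Classifier.χ₀ _ U), ← Category.assoc, eq_top]

theorem comp_χ {V U : E} (m : V ⟶ U) [Mono m] : m ≫ χ m = top V := by
  rw [HasSubobjectClassifier.comm, eq_top]

theorem comp_χ_eq_top_iff {V U W : E} (m : V ⟶ U) [Mono m] (h : W ⟶ U) :
    h ≫ χ m = top W ↔ ∃ k, k ≫ m = h := by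
  constructor
  · intro e
    exact ⟨(isPullback_χ m).lift h (Subobject.Classifier.χ₀ _ W) (by rw [e, eq_top]),
      (isPullback_χ m).lift_fst _ _ _⟩
  · rintro ⟨k, rfl⟩
    rw [Category.assoc, comp_χ, comp_top]

theorem isPullback_of_χ {V U V' U' : E} {m' : V' ⟶ U'} {m : V ⟶ U} {h : U' ⟶ U}
    [Mono m] [Mono m'] (e : h ≫ χ m = χ m') : ∃ a, IsPullback a m' m h := by
  obtain ⟨a, ha⟩ := (comp_χ_eq_top_iff m (m' ≫ h)).1 (by rw [Category.assoc, e, comp_χ])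
  have key : ∀ s : PullbackCone m h, ∃ k, k ≫ m' = s.snd := fun s ↦ by
    rw [← comp_χ_eq_top_iff, ← e, ← Category.assoc, ← s.condition, Category.assoc, comp_χ, comp_top]
  choose k hk using key
  refine ⟨a, ⟨ha⟩, ⟨PullbackCone.IsLimit.mk _ k (fun s ↦ ?_) hk (fun s l _ hl ↦ ?_)⟩⟩
  · rw [← cancel_mono m, Category.assoc, ha, ← Category.assoc, hk, s.condition]
  · rw [← cancel_mono m', hl, hk]

variable [HasFiniteLimits E]

theorem exists_eq_χ {U : E} (p : U ⟶ Ω E) : ∃ (V : E) (m : V ⟶ U) (_ : Mono m), p = χ m :=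
  Subobject.Classifier.surjective_χ _ p

/-- Truth values are equal if they are `true` at the same stages. -/
theorem ext {U : E} {p q : U ⟶ Ω E} (h : ∀ ⦃W : E⦄ (t : W ⟶ U), t ≫ p = top W ↔ t ≫ q = top W) :
    p = q := by
  obtain ⟨V, m, _, rfl⟩ := exists_eq_χ p
  symm
  have hm : m ≫ q = top V := (h m).1 (comp_χ m)
  have key : ∀ s : PullbackCone q (truth E), ∃ k, k ≫ m = s.fst := fun s ↦
    (comp_χ_eq_top_iff m s.fst).1 ((h _).2 (by rw [s.condition, eq_top]))
  choose k hk using key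
  refine unique m q ⟨⟨by rw [hm, eq_top]⟩, ⟨PullbackCone.IsLimit.mk _ k hk
    (fun s ↦ Subsingleton.elim _ _) (fun s l hl _ ↦ ?_)⟩⟩
  rw [← cancel_mono m, hl, hk]

theorem χ_of_isPullback {V U V' U' : E} {m' : V' ⟶ U'} {m : V ⟶ U} {a : V' ⟶ V} {h : U' ⟶ U}
    [Mono m] [Mono m'] (sq : IsPullback a m' m h) : h ≫ χ m = χ m' := by
  refine ext fun W t ↦ ?_
  rw [← Category.assoc, comp_χ_eq_top_iff, comp_χ_eq_top_iff]
  constructor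
  · rintro ⟨k, hk⟩
    exact ⟨sq.lift k t hk, sq.lift_snd _ _ _⟩
  · rintro ⟨k, rfl⟩
    exact ⟨k ≫ a, by simp [sq.w]⟩

theorem omegaMeet_eq_top_iff {W : E} (p q : W ⟶ Ω E) :
    prod.lift p q ≫ omegaMeet E = top W ↔ p = top W ∧ q = top W := by
  rw [omegaMeet, comp_χ_eq_top_iff]
  constructor
  · rintro ⟨k, hk⟩
    have h₁ := hk =≫ prod.fst
    have h₂ := hk =≫ prod.snd
    rw [Category.assoc, prod.lift_fst, prod.lift_fst] at h₁
    rw [Category.assoc, prod.lift_snd, prod.lift_snd] at h₂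
    exact ⟨by rw [← h₁, eq_top], by rw [← h₂, eq_top]⟩
  · rintro ⟨rfl, rfl⟩
    refine ⟨Subobject.Classifier.χ₀ _ W, ?_⟩
    rw [prod.comp_lift, eq_top]

end TruthValue

/-! ### Lawvere–Tierney topologies from classes of monomorphisms -/

namespace LawvereTierneyTopology

open HasSubobjectClassifier TruthValue

variable {E : Type u} [Category.{v} E] [HasFiniteLimits E] [HasSubobjectClassifier E]

theorem denseMonos_iff (J : LawvereTierneyTopology E) {V U : E} (m : V ⟶ U) [Mono m] :
    J.denseMonos m ↔ χ m ≫ J.j = top U :=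
  ⟨fun ⟨_, h⟩ ↦ h, fun h ↦ ⟨inferInstance, h⟩⟩

/-- Every truth value is some `χ m`, and `χ m ≫ j` is true exactly when `m` is dense; truth values
are determined by where they are true. -/
theorem denseMonos_injective :
    Function.Injective (denseMonos : LawvereTierneyTopology E → MorphismProperty E) := by
  intro J J' h
  refine LawvereTierneyTopology.ext (TruthValue.ext fun W t ↦ ?_)
  obtain ⟨V, m, _, rfl⟩ := exists_eq_χ t
  rw [← denseMonos_iff, ← denseMonos_iff, h]

theorem denseMonos_of_isPullback (J : LawvereTierneyTopology E) {V U V' U' : E} {m' : V' ⟶ U'}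
    {m : V ⟶ U} {a : V' ⟶ V} {h : U' ⟶ U} (sq : IsPullback a m' m h) (hm : J.denseMonos m) :
    J.denseMonos m' := by
  obtain ⟨_, hm⟩ := hm
  have : Mono m' := ⟨fun x y e ↦ sq.hom_ext
    (by rw [← cancel_mono m, Category.assoc, Category.assoc, sq.w, reassoc_of% e]) e⟩
  rw [denseMonos_iff, ← χ_of_isPullback sq, Category.assoc, hm]
  exact comp_top h

/-- A class of monomorphisms that is stable under pullbacks and compositions, contains the
identities, contains each monomorphism through which one of its members factors, and is classified
by an endomorphism of `Ω`, is the class of dense monomorphisms of a topology. -/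
theorem exists_denseMonos_eq (P : MorphismProperty E) (hmono : ∀ ⦃V U : E⦄ (m : V ⟶ U), P m → Mono m)
    (hpb : ∀ ⦃V U V' U' : E⦄ ⦃m' : V' ⟶ U'⦄ ⦃m : V ⟶ U⦄ ⦃a : V' ⟶ V⦄ ⦃h : U' ⟶ U⦄,
      IsPullback a m' m h → P m → P m')
    (hid : ∀ U : E, P (𝟙 U)) (hcomp : ∀ ⦃V V' U : E⦄ (a : V ⟶ V') (b : V' ⟶ U), P a → P b → P (a ≫ b))
    (hcancel : ∀ ⦃V V' U : E⦄ (a : V ⟶ V') (b : V' ⟶ U), Mono b → P (a ≫ b) → P b)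
    (hj : ∃ j : Ω E ⟶ Ω E, ∀ ⦃V U : E⦄ (m : V ⟶ U) [Mono m], χ m ≫ j = top U ↔ P m) :
    ∃ J : LawvereTierneyTopology E, J.denseMonos = P := by
  obtain ⟨j, hj⟩ := hj
  have hχ : ∀ ⦃V U V' U' : E⦄ (m : V ⟶ U) (m' : V' ⟶ U') (h : U' ⟶ U) [Mono m] [Mono m'],
      h ≫ χ m = χ m' → P m → P m' := by
    intro V U V' U' m m' h _ _ e hm
    obtain ⟨a, ha⟩ := isPullback_of_χ e
    exact hpb ha hm
  have htop : ∀ U : E, top U ≫ j = top U := fun U ↦ (hj (𝟙 U)).2 (hid U)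
  refine ⟨⟨j, ?_, ?_, ?_⟩, ?_⟩
  · rw [← Category.id_comp (truth E), eq_top, htop]
  · refine TruthValue.ext fun W t ↦ ⟨fun h ↦ ?_, fun h ↦ ?_⟩
    · obtain ⟨V, m, _, rfl⟩ := exists_eq_χ t
      -- `n` is the closure of `m`. The factor `a` of `m` through `n` is the pullback of `m` along
      -- `n`, so `m` is dense in its closure, and composing with a dense `n` makes `m` dense.
      obtain ⟨V', n, _, hn⟩ := exists_eq_χ (χ m ≫ j)
      rw [← Category.assoc, hn] at h
      have hn' : P n := (hj n).1 h
      obtain ⟨a, ha⟩ := (comp_χ_eq_top_iff n m).1 (by rw [← hn, ← Category.assoc, comp_χ, htop])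
      have : Mono a := mono_of_mono_fac ha
      have e : n ≫ χ m = χ a := by
        refine TruthValue.ext fun T k ↦ ?_
        rw [← Category.assoc, comp_χ_eq_top_iff, comp_χ_eq_top_iff]
        refine exists_congr fun l ↦ ?_
        rw [← cancel_mono n, Category.assoc, ha]
      have hPa : P a := by
        rw [← hj, ← e, Category.assoc, hn, comp_χ]
      rw [hj, ← ha]
      exact hcomp a n hPa hn'
    · rw [← Category.assoc, h, htop]
  · refine TruthValue.ext fun W t ↦ ?_
    obtain ⟨p, q, rfl⟩ : ∃ p q, t = prod.lift p q :=
      ⟨t ≫ prod.fst, t ≫ prod.snd, by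
        apply Limits.prod.hom_ext
        · rw [prod.lift_fst]
        · rw [prod.lift_snd]⟩
    rw [← Category.assoc, ← Category.assoc, prod.lift_map, omegaMeet_eq_top_iff]
    obtain ⟨V, m, _, rfl⟩ := exists_eq_χ p
    obtain ⟨V', n, _, rfl⟩ := exists_eq_χ q
    obtain ⟨L, l, _, hl⟩ := exists_eq_χ (prod.lift (χ m) (χ n) ≫ omegaMeet E)
    have hl' : ∀ {T : E} (k : T ⟶ W), k ≫ χ l = top T ↔ k ≫ χ m = top T ∧ k ≫ χ n = top T := by
      intro T k
      rw [← hl, ← Category.assoc, prod.comp_lift, omegaMeet_eq_top_iff]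
    rw [hl, hj, hj, hj]
    obtain ⟨h₁, h₂⟩ := (hl' l).1 (comp_χ l)
    obtain ⟨a, ha⟩ := (comp_χ_eq_top_iff m l).1 h₁
    obtain ⟨b, hb⟩ := (comp_χ_eq_top_iff n l).1 h₂
    refine ⟨fun h ↦ ⟨hcancel a m inferInstance (by rwa [ha]),
      hcancel b n inferInstance (by rwa [hb])⟩, fun ⟨hm, hn⟩ ↦ ?_⟩
    have : Mono a := mono_of_mono_fac ha
    rw [← ha]
    -- The intersection `l` is `a ≫ m`, where `a` is the pullback of `n` along `m`.
    refine hcomp a m (hχ n a m (TruthValue.ext fun T k ↦ ?_) hn) hm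
    rw [← Category.assoc, comp_χ_eq_top_iff a]
    trans (k ≫ m) ≫ χ l = top T
    · rw [hl', Category.assoc k m (χ m), comp_χ, comp_top]
      simp
    · rw [comp_χ_eq_top_iff]
      refine exists_congr fun x ↦ ?_
      rw [← cancel_mono m, Category.assoc, ha]
  · ext V U m
    refine ⟨fun ⟨_, h⟩ ↦ (hj m).1 h, fun h ↦ ?_⟩
    have := hmono m h
    exact ⟨this, (hj m).2 h⟩

variable (J : LawvereTierneyTopology E)

theorem top_j (U : E) : top U ≫ J.j = top U := by
  rw [← eq_top (Subobject.Classifier.χ₀ _ U), Category.assoc, J.truth_j]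

/-- A closed truth value that is `true` on a dense subobject is `true`. -/
theorem eq_top_of_closed {V U : E} {m : V ⟶ U} (hm : J.denseMonos m) {q : U ⟶ Ω E}
    (hq : q ≫ J.j = q) (h : m ≫ q = top V) : q = top U := by
  obtain ⟨_, hm⟩ := hm
  -- Since `m` lies below `q`, meeting with `q` leaves `χ m` unchanged; applying `j` to this
  -- equation gives `true = true ∧ q`.
  have e : prod.lift (χ m) q ≫ omegaMeet E = χ m := by
    refine TruthValue.ext fun T k ↦ ?_
    rw [← Category.assoc, prod.comp_lift, omegaMeet_eq_top_iff, and_iff_left_iff_imp,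
      comp_χ_eq_top_iff]
    rintro ⟨l, rfl⟩
    rw [Category.assoc, h, comp_top]
  have h' := prod.lift (χ m) q ≫= J.meet_j
  rw [← Category.assoc, e, hm, ← Category.assoc, prod.lift_map, hq] at h'
  exact ((omegaMeet_eq_top_iff _ _).1 h'.symm).2

/-- Closed truth values are determined by their restriction to a dense subobject. -/
theorem closed_ext {V U : E} {m : V ⟶ U} (hm : J.denseMonos m) {q q' : U ⟶ Ω E}
    (hq : q ≫ J.j = q) (hq' : q' ≫ J.j = q') (h : m ≫ q = m ≫ q') : q = q' := by
  have key : ∀ {q q' : U ⟶ Ω E}, q' ≫ J.j = q' → m ≫ q = m ≫ q' →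
      ∀ ⦃W : E⦄ (t : W ⟶ U), t ≫ q = top W → t ≫ q' = top W := by
    intro q q' hq' h W t ht
    refine J.eq_top_of_closed
      (J.denseMonos_of_isPullback (IsPullback.of_hasPullback m t) hm) (by rw [Category.assoc, hq']) ?_
    rw [← Category.assoc, ← pullback.condition, Category.assoc, ← h, ← Category.assoc,
      pullback.condition, Category.assoc, ht, comp_top]
  exact TruthValue.ext fun W t ↦ ⟨key hq' h t, key hq h.symm t⟩

/-- The object of closed truth values is a sheaf. -/
theorem sheaves_equalizer : J.sheaves (equalizer J.j (𝟙 (Ω E))) := by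
  intro V U m hm
  constructor
  · intro g g' h
    dsimp only at h
    rw [← cancel_mono (equalizer.ι _ _)]
    have hc : ∀ g : U ⟶ equalizer J.j (𝟙 (Ω E)),
        (g ≫ equalizer.ι _ _) ≫ J.j = g ≫ equalizer.ι _ _ := fun g ↦ by
      rw [Category.assoc, equalizer.condition, Category.comp_id]
    exact J.closed_ext hm (hc g) (hc g') (by rw [reassoc_of% h])
  · intro g
    have := hm.1
    obtain ⟨A, a, _, ha⟩ := exists_eq_χ (g ≫ equalizer.ι _ _)
    -- A closed subobject `a` of `V` extends to the closure in `U` of its image under `m`.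
    refine ⟨equalizer.lift (χ (a ≫ m) ≫ J.j) (by rw [Category.assoc, J.j_j, Category.comp_id]), ?_⟩
    dsimp only
    rw [← cancel_mono (equalizer.ι _ _), Category.assoc, equalizer.lift_ι]
    have e : m ≫ χ (a ≫ m) = χ a := by
      refine TruthValue.ext fun T k ↦ ?_
      rw [← Category.assoc, comp_χ_eq_top_iff, comp_χ_eq_top_iff]
      refine exists_congr fun l ↦ ?_
      rw [← cancel_mono m, Category.assoc]
    rw [← Category.assoc, e, ← ha, Category.assoc, equalizer.condition, Category.comp_id]

/-- A monomorphism that all sheaves take to a bijection is dense. -/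
theorem denseMonos_of_sheaves {V U : E} (m : V ⟶ U) [Mono m]
    (h : ∀ F, J.sheaves F → Function.Injective (fun g : U ⟶ F ↦ m ≫ g)) : J.denseMonos m := by
  rw [denseMonos_iff]
  have h₁ : (χ m ≫ J.j) ≫ J.j = (χ m ≫ J.j) ≫ 𝟙 (Ω E) := by
    rw [Category.assoc, J.j_j, Category.comp_id]
  have h₂ : top U ≫ J.j = top U ≫ 𝟙 (Ω E) := by rw [J.top_j, Category.comp_id]
  -- Test against the sheaf of closed truth values: the closure of `m` and `true` agree on `V`, so
  -- they agree on `U`.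
  have e : equalizer.lift (χ m ≫ J.j) h₁ = equalizer.lift (top U) h₂ := by
    refine h _ J.sheaves_equalizer ?_
    dsimp only
    rw [← cancel_mono (equalizer.ι _ _), Category.assoc m, Category.assoc m, equalizer.lift_ι,
      equalizer.lift_ι, ← Category.assoc, comp_χ, J.top_j, comp_top]
  simpa using e =≫ equalizer.ι _ _

end LawvereTierneyTopology

/-! ### Pure and dense monomorphisms in terms of restriction maps -/

/-- The closure properties of the classes of injective and of bijective maps that make the
monomorphisms along which all restriction maps are in the class the dense ones of a topology. -/
structure IsRestrictionClass (Q : ∀ ⦃α β : Type v⦄, (α → β) → Prop) : Prop where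
  of_bijective : ∀ ⦃α β : Type v⦄ {f : α → β}, Function.Bijective f → Q f
  comp : ∀ ⦃α β γ : Type v⦄ {f : α → β} {g : β → γ}, Q g → Q f → Q (g ∘ f)
  of_comp : ∀ ⦃α β γ : Type v⦄ {f : α → β} {g : β → γ}, Q (g ∘ f) → Q g → Q f

theorem IsRestrictionClass.bijective :
    IsRestrictionClass.{v} fun _ _ f ↦ Function.Bijective f where
  of_bijective _ _ _ h := h
  comp _ _ _ _ _ hg hf := hg.comp hf
  of_comp _ _ _ _ _ h hg := (Function.Bijective.of_comp_iff' hg _).1 h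

theorem IsRestrictionClass.injective :
    IsRestrictionClass.{v} fun _ _ f ↦ Function.Injective f where
  of_bijective _ _ _ h := h.1
  comp _ _ _ _ _ hg hf := hg.comp hf
  of_comp _ _ _ _ _ h _ := h.of_comp

/-- A commutative square of maps with bijective sides is enough to transfer membership. -/
theorem IsRestrictionClass.iff_of_equiv {Q : ∀ ⦃α β : Type v⦄, (α → β) → Prop}
    (hQ : IsRestrictionClass Q) {α β α' β' : Type v} {f : α → β} {f' : α' → β'} (e₁ : α ≃ α')
    (e₂ : β ≃ β') (h : ∀ x, e₂ (f x) = f' (e₁ x)) : Q f ↔ Q f' := by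
  have key : ∀ {α β α' β' : Type v} {f : α → β} {f' : α' → β'} (e₁ : α ≃ α')
    (e₂ : β ≃ β') (_ : ∀ x, e₂ (f x) = f' (e₁ x)), Q f → Q f' := by
    intro α β α' β' f f' e₁ e₂ h hf
    have : f' = (e₂ ∘ f) ∘ e₁.symm := by
      funext x
      simp [h]
    rw [this]
    exact hQ.comp (hQ.comp (hQ.of_bijective e₂.bijective) hf) (hQ.of_bijective e₁.symm.bijective)
  refine ⟨key e₁ e₂ h, key e₁.symm e₂.symm fun x ↦ ?_⟩
  rw [Equiv.symm_apply_eq, h, Equiv.apply_symm_apply]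

theorem CategoryTheory.Adjunction.homEquiv_symm_comp_unit {C : Type u} [Category.{v} C]
    {D : Type u₁} [Category.{v₁} D] {L : C ⥤ D} {R : D ⥤ C} (adj : L ⊣ R) {X Y : C} (g : X ⟶ Y) :
    (adj.homEquiv X (L.obj Y)).symm (g ≫ adj.unit.app Y) = L.map g := by
  simp [Adjunction.homEquiv_counit]

namespace IsGrothendieckTopos

variable {E : Type u} [Category.{v} E] [IsGrothendieckTopos E]

/-- The monomorphisms `V ⟶ U` such that for each `W ⟶ U` and each `X` in `A` the restriction map
`Hom(W, X) → Hom(W ×_U V, X)` is in `Q`. -/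
def restrictionMonos (Q : ∀ ⦃α β : Type v⦄, (α → β) → Prop) (A : ObjectProperty E) :
    MorphismProperty E := fun _ U m ↦
  Mono m ∧ ∀ X, A X → ∀ ⦃W : E⦄ (h : W ⟶ U), Q (fun g : W ⟶ X ↦ pullback.fst h m ≫ g)

/-- Composition with the unit of the adjunction between slices is restriction. -/
theorem comp_adj_unit_iff {Q : ∀ ⦃α β : Type v⦄, (α → β) → Prop} (hQ : IsRestrictionClass Q)
    {V U : E} (m : V ⟶ U) {R : Over V ⥤ Over U} (adj : Over.pullback m ⊣ R) (X : E)
    (h : Over U) :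
    Q (fun g : h ⟶ (Over.star U).obj X ↦ g ≫ adj.unit.app _) ↔
      Q (fun g : h.left ⟶ X ↦ pullback.fst h.hom m ≫ g) := by
  -- Maps into `R m^* π_U^* X` are transposed to maps over `V`, then to maps over `U`, then to maps
  -- into `X` in `E`.
  refine hQ.iff_of_equiv ((Over.forgetAdjStar U).homEquiv h X).symm
    ((adj.homEquiv _ ((Over.pullback m).obj ((Over.star U).obj X))).symm.trans
      ((((Over.mapPullbackAdj m).homEquiv _ ((Over.star U).obj X)).symm).trans
        ((Over.forgetAdjStar U).homEquiv _ X).symm)) fun g ↦ ?_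
  have e₁ : (adj.homEquiv h _).symm (g ≫ adj.unit.app _) = (Over.pullback m).map g :=
    adj.homEquiv_symm_comp_unit g
  have e₂ : ((Over.mapPullbackAdj m).homEquiv _ _).symm ((Over.pullback m).map g) =
      (Over.mapPullbackAdj m).counit.app h ≫ g := by
    rw [Adjunction.homEquiv_counit]
    exact (Over.mapPullbackAdj m).counit.naturality g
  refine (congrArg (fun x ↦ ((Over.forgetAdjStar U).homEquiv _ X).symm
    (((Over.mapPullbackAdj m).homEquiv _ _).symm x)) e₁).trans ?_
  refine (congrArg ((Over.forgetAdjStar U).homEquiv _ X).symm e₂).trans ?_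
  refine ((Over.forgetAdjStar U).homEquiv_naturality_left_symm _ _).trans ?_
  congr 1
  simp

/-- Composition with the unit of the geometric morphism between slices is restriction. -/
theorem comp_unit_iff {Q : ∀ ⦃α β : Type v⦄, (α → β) → Prop} (hQ : IsRestrictionClass Q)
    {V U : E} (m : V ⟶ U) (X : E) {W : E} (h : W ⟶ U) :
    Q (fun g : Over.mk h ⟶ (Over.star U).obj X ↦ g ≫ (sliceMorphism m).adj.unit.app _) ↔
      Q (fun g : W ⟶ X ↦ pullback.fst h m ≫ g) :=
  comp_adj_unit_iff hQ m (sliceMorphism m).adj X (Over.mk h)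

theorem pureMonos_eq (A : ObjectProperty E) :
    pureMonos A = restrictionMonos (fun _ _ f ↦ Function.Bijective f) A := by
  ext V U m
  refine and_congr_right fun _ ↦ ⟨fun h X hX W k ↦ ?_, ?_⟩
  · have := h _ (ObjectProperty.strictMap_obj _ _ hX)
    refine (comp_unit_iff IsRestrictionClass.bijective m X k).1 ?_
    exact (isIso_iff_yoneda_map_bijective _).1 this _
  · rintro h _ ⟨X, hX⟩
    rw [isIso_iff_yoneda_map_bijective]
    exact fun k ↦ (comp_unit_iff IsRestrictionClass.bijective m X k.hom).2 (h X hX k.hom)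

theorem denseMonos_eq (A : ObjectProperty E) :
    denseMonos A = restrictionMonos (fun _ _ f ↦ Function.Injective f) A := by
  ext V U m
  refine and_congr_right fun _ ↦ ⟨fun h X hX W k ↦ ?_, ?_⟩
  · have := h _ (ObjectProperty.strictMap_obj _ _ hX)
    refine (comp_unit_iff IsRestrictionClass.injective m X k).1 ?_
    exact fun _ _ e ↦ this.right_cancellation _ _ e
  · rintro h _ ⟨X, hX⟩
    exact ⟨fun {k} _ _ e ↦ (comp_unit_iff IsRestrictionClass.injective m X k.hom).2 (h X hX k.hom) e⟩

/-- Universal quantification of the subobject `a` along `z`. -/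
theorem exists_forall {B Z U : E} (a : B ⟶ Z) [Mono a] (z : Z ⟶ U) :
    ∃ (M : E) (n : M ⟶ U) (_ : Mono n), ∀ ⦃W : E⦄ (h : W ⟶ U), (∃ k, k ≫ n = h) ↔
      ∀ ⦃T : E⦄ (t : T ⟶ W) (s : T ⟶ Z), s ≫ z = t ≫ h → ∃ r, r ≫ a = s := by
  let R := (Over.pullback z).rightAdjoint
  let adj : Over.pullback z ⊣ R := Adjunction.ofIsLeftAdjoint _
  refine ⟨_, (R.obj (Over.mk a)).hom, ⟨fun {T} k k' e ↦ ?_⟩, fun W h ↦ ⟨?_, fun H ↦ ?_⟩⟩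
  · let l : Over.mk (k ≫ (R.obj (Over.mk a)).hom) ⟶ R.obj (Over.mk a) := Over.homMk k
    let l' : Over.mk (k ≫ (R.obj (Over.mk a)).hom) ⟶ R.obj (Over.mk a) := Over.homMk k' e.symm
    -- Morphisms over `U` into the dependent product correspond to morphisms over `Z` into the mono
    -- `a`, and there is at most one of those.
    have : l = l' := by
      apply (adj.homEquiv _ _).symm.injective
      ext
      rw [← cancel_mono a]
      exact (Over.w ((adj.homEquiv _ _).symm l)).trans (Over.w ((adj.homEquiv _ _).symm l')).symm
    exact congr($(this).left)
  · rintro ⟨k, rfl⟩ T t s hs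
    let l : Over.mk (k ≫ (R.obj (Over.mk a)).hom) ⟶ R.obj (Over.mk a) := Over.homMk k
    refine ⟨pullback.lift t s hs.symm ≫ ((adj.homEquiv _ _).symm l).left, ?_⟩
    have := Over.w ((adj.homEquiv _ _).symm l)
    rw [Category.assoc]
    exact (congr(_ ≫ $this)).trans (pullback.lift_snd _ _ _)
  · obtain ⟨r, hr⟩ := H (pullback.fst h z) (pullback.snd h z) pullback.condition.symm
    let l : (Over.pullback z).obj (Over.mk h) ⟶ Over.mk a := Over.homMk r hr
    exact ⟨(adj.homEquiv _ _ l).left, Over.w (adj.homEquiv _ _ l)⟩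

/-- The largest subobject of `U` over which the morphism `f` over `U` is a monomorphism. -/
theorem exists_injective_locus {U : E} {Y Z : Over U} (f : Y ⟶ Z) :
    ∃ (M : E) (n : M ⟶ U) (_ : Mono n), ∀ ⦃W : E⦄ (h : W ⟶ U), (∃ k, k ≫ n = h) ↔
      ∀ ⦃T : E⦄ (t : T ⟶ W), Function.Injective (fun y : Over.mk (t ≫ h) ⟶ Y ↦ y ≫ f) := by
  -- `f` is mono over `W` iff the diagonal of its kernel pair is everything there, so quantify that
  -- diagonal along the projection of the kernel pair to `U`.
  obtain ⟨M, n, hn, H⟩ := exists_forall (pullback.diagonal f.left)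
    (pullback.fst f.left f.left ≫ Y.hom)
  refine ⟨M, n, hn, fun W h ↦ (H h).trans ⟨fun h' T t y y' e ↦ ?_, fun h' T t s hs ↦ ?_⟩⟩
  · obtain ⟨r, hr⟩ := h' t (pullback.lift y.left y'.left congr($(e).left)) (by
      rw [pullback.lift_fst_assoc]; exact Over.w y)
    ext
    have h₁ := hr =≫ pullback.fst _ _
    have h₂ := hr =≫ pullback.snd _ _
    rw [Category.assoc, pullback.diagonal_fst, pullback.lift_fst] at h₁
    rw [Category.assoc, pullback.diagonal_snd, pullback.lift_snd] at h₂
    rw [← h₁, ← h₂]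
  · have hw : s ≫ pullback.snd f.left f.left ≫ Y.hom = t ≫ h := by
      rw [← hs, ← Over.w f, pullback.condition_assoc]
    let y : Over.mk (t ≫ h) ⟶ Y := Over.homMk (s ≫ pullback.fst _ _) (by simpa using hs)
    let y' : Over.mk (t ≫ h) ⟶ Y := Over.homMk (s ≫ pullback.snd _ _) (by simpa using hw)
    have e : y = y' := h' t (by
      ext
      exact (Category.assoc _ _ _).trans
        ((s ≫= pullback.condition).trans (Category.assoc _ _ _).symm))
    refine ⟨s ≫ pullback.fst _ _, ?_⟩
    apply pullback.hom_ext
    · simp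
    · have : s ≫ pullback.fst _ _ = s ≫ pullback.snd _ _ := congr($(e).left)
      simpa using this

/-- The largest subobject of `U` over which the morphism `f` over `U` is an isomorphism. -/
theorem exists_bijective_locus {U : E} {Y Z : Over U} (f : Y ⟶ Z) :
    ∃ (M : E) (n : M ⟶ U) (_ : Mono n), ∀ ⦃W : E⦄ (h : W ⟶ U), (∃ k, k ≫ n = h) ↔
      ∀ ⦃T : E⦄ (t : T ⟶ W), Function.Bijective (fun y : Over.mk (t ≫ h) ⟶ Y ↦ y ≫ f) := by
  obtain ⟨M, n, _, H⟩ := exists_injective_locus f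
  -- Restricted to the injective locus, `f` becomes the monomorphism `a`; quantifying it along `Z
  -- ×_U M ⟶ M` cuts out where it is also surjective.
  let a : pullback Y.hom n ⟶ pullback Z.hom n :=
    pullback.lift (pullback.fst _ _ ≫ f.left) (pullback.snd _ _) (by
      rw [Category.assoc, Over.w, pullback.condition])
  have ha : Mono a := ⟨fun {T} k k' e ↦ by
    have e₁ := e =≫ pullback.fst _ _
    have e₂ := e =≫ pullback.snd _ _
    simp only [a, Category.assoc, pullback.lift_fst, pullback.lift_snd] at e₁ e₂
    apply pullback.hom_ext _ e₂
    let y : Over.mk (k ≫ pullback.snd _ _ ≫ n) ⟶ Y := Over.homMk (k ≫ pullback.fst _ _) (by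
      simp [pullback.condition])
    let y' : Over.mk (k ≫ pullback.snd _ _ ≫ n) ⟶ Y := Over.homMk (k' ≫ pullback.fst _ _) (by
      simp only [Category.assoc, Over.mk_hom]
      rw [reassoc_of% e₂, pullback.condition])
    have : y = y' := (H (pullback.snd _ _ ≫ n)).1 ⟨_, rfl⟩ k (by
      ext
      exact (Category.assoc _ _ _).trans (e₁.trans (Category.assoc _ _ _).symm))
    exact congr($(this).left)⟩
  obtain ⟨M', n', _, H'⟩ := exists_forall a (pullback.snd Z.hom n)
  refine ⟨M', n' ≫ n, inferInstance, fun W h ↦ ⟨?_, fun h' ↦ ?_⟩⟩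
  · rintro ⟨k, rfl⟩ T t
    refine ⟨(H (k ≫ n' ≫ n)).1 ⟨k ≫ n', Category.assoc _ _ _⟩ t, fun s ↦ ?_⟩
    obtain ⟨r, hr⟩ := (H' (k ≫ n')).1 ⟨k, rfl⟩ t (pullback.lift s.left (t ≫ k ≫ n') (by
      refine (Over.w s).trans (?_ : t ≫ k ≫ n' ≫ n = (t ≫ k ≫ n') ≫ n)
      simp)) (pullback.lift_snd _ _ _)
    have h₁ := hr =≫ pullback.fst _ _
    have h₂ := hr =≫ pullback.snd _ _
    simp only [a, Category.assoc, pullback.lift_fst, pullback.lift_snd] at h₁ h₂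
    refine ⟨Over.homMk (r ≫ pullback.fst _ _) ?_, ?_⟩
    · rw [Category.assoc, pullback.condition, reassoc_of% h₂]
      simp
    · ext
      simpa using h₁
  · obtain ⟨k, rfl⟩ := (H h).2 fun T t ↦ (h' t).1
    obtain ⟨k', rfl⟩ := (H' k).2 fun T t s hs ↦ by
      obtain ⟨y, hy⟩ := (h' t).2 (Over.homMk (s ≫ pullback.fst _ _) (by
        simp [pullback.condition, reassoc_of% hs]))
      refine ⟨pullback.lift y.left (t ≫ k) (by simp), ?_⟩
      apply pullback.hom_ext
      · simp only [a, Category.assoc, pullback.lift_fst, pullback.lift_fst_assoc]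
        exact congr($(hy).left)
      · simp only [a, Category.assoc, pullback.lift_snd]
        exact hs.symm
    exact ⟨k', by simp⟩

/-! ### The topology of a restriction class -/

open HasSubobjectClassifier TruthValue

section

variable {Q : ∀ ⦃α β : Type v⦄, (α → β) → Prop} (hQ : IsRestrictionClass Q)

include hQ

theorem restriction_iff {V U W P : E} {m : V ⟶ U} {h : W ⟶ U} {a : P ⟶ W}
    {b : P ⟶ V} (sq : IsPullback a b h m) (X : E) :
    Q (fun g : W ⟶ X ↦ pullback.fst h m ≫ g) ↔ Q (fun g : W ⟶ X ↦ a ≫ g) := by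
  refine (hQ.iff_of_equiv (Equiv.refl _) sq.isoPullback.homFromEquiv fun g ↦ ?_).symm
  simp

/-- By pasting pullbacks, restriction along `a ≫ b` is restriction along `b` followed by restriction
along `a`. -/
theorem restriction_comp_iff {V V' U W : E} (a : V ⟶ V') (b : V' ⟶ U) (h : W ⟶ U) (X : E) :
    Q (fun g : W ⟶ X ↦ pullback.fst h (a ≫ b) ≫ g) ↔
      Q ((fun g : pullback h b ⟶ X ↦ pullback.fst (pullback.snd h b) a ≫ g) ∘
        (fun g : W ⟶ X ↦ pullback.fst h b ≫ g)) := by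
  rw [restriction_iff hQ (((IsPullback.of_hasPullback (pullback.snd h b) a).flip.paste_vert
    (IsPullback.of_hasPullback h b).flip).flip)]
  simp [Function.comp_def]

/-- An endomorphism of `Ω` that classifies the monomorphisms along which the restriction maps for
`X` are in `Q`. -/
theorem exists_classifying_single
    (hloc : ∀ ⦃U : E⦄ ⦃Y Z : Over U⦄ (f : Y ⟶ Z), ∃ (M : E) (n : M ⟶ U) (_ : Mono n),
      ∀ ⦃W : E⦄ (h : W ⟶ U), (∃ k, k ≫ n = h) ↔
        ∀ ⦃T : E⦄ (t : T ⟶ W), Q (fun y : Over.mk (t ≫ h) ⟶ Y ↦ y ≫ f)) (X : E) :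
    ∃ j : Ω E ⟶ Ω E, ∀ ⦃V U : E⦄ (m : V ⟶ U) [Mono m], χ m ≫ j = top U ↔
      ∀ ⦃W : E⦄ (h : W ⟶ U), Q (fun g : W ⟶ X ↦ pullback.fst h m ≫ g) := by
  -- The mono `truth` is the universal case: its pullback along `t ≫ χ m` is the pullback of `m`
  -- along `t`.
  obtain ⟨M, n, _, H⟩ := hloc
    ((sliceMorphism (truth E)).adj.unit.app ((Over.star (Ω E)).obj X))
  refine ⟨χ n, fun V U m _ ↦ ?_⟩
  rw [comp_χ_eq_top_iff, H]
  refine forall_congr' fun T ↦ forall_congr' fun t ↦ ?_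
  exact (comp_unit_iff hQ (truth E) X (t ≫ χ m)).trans (restriction_iff hQ
    ((IsPullback.of_hasPullback t m).paste_vert (isPullback_χ m)) X)

end

/-- Intersections of the subobjects of `Ω` classified by a class of endomorphisms. -/
theorem exists_classifying_forall (S : (Ω E ⟶ Ω E) → Prop) :
    ∃ j : Ω E ⟶ Ω E, ∀ ⦃U : E⦄ (p : U ⟶ Ω E), p ≫ j = top U ↔ ∀ f, S f → p ≫ f = top U := by
  obtain ⟨C, _, K, ⟨e⟩⟩ := exists_equivalence (E := E)
  have : HasProducts.{v} E := fun J ↦ Adjunction.hasLimitsOfShape_of_equivalence e.functor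
  -- Although `S` may come from a large class of objects, it is indexed by a subtype of `Hom(Ω, Ω)`,
  -- hence `v`-small, so the product exists. The equalizer is the locus where all members of `S` are
  -- true.
  let α : Ω E ⟶ ∏ᶜ fun _ : {f // S f} ↦ Ω E := Pi.lift fun f ↦ f.1
  let β : Ω E ⟶ ∏ᶜ fun _ : {f // S f} ↦ Ω E := Pi.lift fun f ↦ top (Ω E)
  refine ⟨χ (equalizer.ι α β), fun U p ↦ ?_⟩
  rw [comp_χ_eq_top_iff]
  trans p ≫ α = p ≫ β
  · constructor
    · rintro ⟨k, rfl⟩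
      rw [Category.assoc, Category.assoc, equalizer.condition]
    · exact fun h ↦ ⟨equalizer.lift p h, equalizer.lift_ι _ _⟩
  · constructor
    · intro h f hf
      have := h =≫ Pi.π _ ⟨f, hf⟩
      simpa [α, β, comp_top] using this
    · intro h
      refine Limits.Pi.hom_ext _ _ fun f ↦ ?_
      simpa [α, β, comp_top] using h f.1 f.2

/-- The monomorphisms along which all restriction maps are in `Q` are the dense monomorphisms of a
topology. -/
theorem exists_denseMonos_eq_restrictionMonos {Q : ∀ ⦃α β : Type v⦄, (α → β) → Prop}
    (hQ : IsRestrictionClass Q)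
    (hloc : ∀ ⦃U : E⦄ ⦃Y Z : Over U⦄ (f : Y ⟶ Z), ∃ (M : E) (n : M ⟶ U) (_ : Mono n),
      ∀ ⦃W : E⦄ (h : W ⟶ U), (∃ k, k ≫ n = h) ↔
        ∀ ⦃T : E⦄ (t : T ⟶ W), Q (fun y : Over.mk (t ≫ h) ⟶ Y ↦ y ≫ f))
    (A : ObjectProperty E) :
    ∃ J : LawvereTierneyTopology E, J.denseMonos = restrictionMonos Q A := by
  have hpb : ∀ ⦃V U V' U' : E⦄ ⦃m' : V' ⟶ U'⦄ ⦃m : V ⟶ U⦄ ⦃a : V' ⟶ V⦄ ⦃h : U' ⟶ U⦄,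
      IsPullback a m' m h → restrictionMonos Q A m → restrictionMonos Q A m' := by
    intro V U V' U' m' m a h sq hm
    have := hm.1
    refine ⟨⟨fun x y e ↦ sq.hom_ext
      (by rw [← cancel_mono m, Category.assoc, Category.assoc, sq.w, reassoc_of% e]) e⟩,
      fun X hX W k ↦ ?_⟩
    exact (restriction_iff hQ ((IsPullback.of_hasPullback k m').paste_vert sq.flip) X).1
      (hm.2 X hX (k ≫ h))
  refine LawvereTierneyTopology.exists_denseMonos_eq _ (fun V U m hm ↦ hm.1) hpb ?_ ?_ ?_ ?_
  · intro U
    refine ⟨inferInstance, fun X _ W h ↦ hQ.of_bijective ?_⟩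
    exact (isIso_iff_coyoneda_map_bijective _).1 inferInstance X
  · intro V V' U a b ha hb
    have := ha.1
    have := hb.1
    exact ⟨inferInstance, fun X hX W h ↦ (restriction_comp_iff hQ a b h X).2
      (hQ.comp (ha.2 X hX _) (hb.2 X hX h))⟩
  · intro V V' U a b hb hab
    -- As `b` is mono, `a` is the pullback of `a ≫ b` along `b`, so it is in the class too; this
    -- supplies the second input of `of_comp`.
    have sq : IsPullback (𝟙 V) a (a ≫ b) b := IsPullback.of_isLimit
      (PullbackCone.IsLimit.mk (by simp) (fun s ↦ s.fst) (fun s ↦ by simp)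
        (fun s ↦ by rw [← cancel_mono b, Category.assoc, s.condition])
        (fun s l h₁ _ ↦ by simpa using h₁))
    exact ⟨hb, fun X hX W h ↦ hQ.of_comp ((restriction_comp_iff hQ a b h X).1 (hab.2 X hX h))
      ((hpb sq hab).2 X hX _)⟩
  · choose j hj using exists_classifying_single hQ hloc
    obtain ⟨k, hk⟩ := exists_classifying_forall (E := E) fun f ↦ ∃ X, A X ∧ j X = f
    refine ⟨k, fun V U m hm ↦ ?_⟩
    rw [hk]
    constructor
    · exact fun h ↦ ⟨hm, fun X hX ↦ (hj X m).1 (h _ ⟨X, hX, rfl⟩)⟩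
    · rintro h _ ⟨X, hX, rfl⟩
      exact (hj X m).2 (h.2 X hX)

theorem exists_denseMonos_eq_pureMonos (A : ObjectProperty E) :
    ∃ J : LawvereTierneyTopology E, J.denseMonos = pureMonos A := by
  rw [pureMonos_eq]
  exact exists_denseMonos_eq_restrictionMonos .bijective (fun _ _ _ ↦ exists_bijective_locus) A

theorem exists_denseMonos_eq_denseMonos (A : ObjectProperty E) :
    ∃ J : LawvereTierneyTopology E, J.denseMonos = _root_.denseMonos A := by
  rw [denseMonos_eq]
  exact exists_denseMonos_eq_restrictionMonos .injective (fun _ _ _ ↦ exists_injective_locus) A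

end IsGrothendieckTopos

/-! ### The subtopos of sheaves for a Lawvere–Tierney topology -/

namespace SieveOfSection

variable {C : Type v} [SmallCategory C] {F G : Cᵒᵖ ⥤ Type v} (m : F ⟶ G)

/-- The sieve of the morphisms that restrict the section `x` of `G` into the image of `m` is the
pullback of `m` along `x`. -/
theorem isPullback_imageSieve [Mono m] {c : C} (x : G.obj (op c)) :
    ∃ a, IsPullback a (Presheaf.imageSieve m x).functorInclusion m (yonedaEquiv.symm x) := by
  have hm : ∀ d : C, Function.Injective (m.app (op d)) := fun d ↦
    (mono_iff_injective _).1 inferInstance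
  have key : ∀ {d : C} (g : (Presheaf.imageSieve m x).functor.obj (op d)),
      ∃ t, m.app (op d) t = G.map g.1.op x := fun g ↦ g.2
  choose t ht using @key
  let a : (Presheaf.imageSieve m x).functor ⟶ F :=
    { app := fun d ↦ ↾(fun g ↦ t (d := d.unop) g)
      naturality := by
        rintro ⟨d⟩ ⟨d'⟩ k
        ext g
        apply hm
        change m.app (op d') (t _) = m.app (op d') (F.map k (t g))
        rw [NatTrans.naturality_apply, ht, ht, ← Functor.map_comp_apply]
        rfl }
  refine ⟨a, IsPullback.iff_app.2 fun ⟨d⟩ ↦ (Types.isPullback_iff _ _ _ _).2 ⟨?_, ?_, ?_⟩⟩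
  · ext g
    exact ht g
  · rintro g g' ⟨-, h⟩
    exact Subtype.ext h
  · intro s g h
    refine ⟨⟨g, s, h⟩, hm d ?_, rfl⟩
    exact (ht _).trans h.symm

end SieveOfSection

namespace LawvereTierneyTopology

variable {E : Type u} [Category.{v} E] [IsGrothendieckTopos E] (J : LawvereTierneyTopology E)

section

variable {C : Type v} [SmallCategory C] {K : GrothendieckTopology C} (e : E ≌ Sheaf K (Type v))

/-- The topology on the site `C` of `E` that corresponds to `J`: the finest one for which all
`J`-sheaves are sheaves. -/
def siteTopology : GrothendieckTopology C :=
  Sheaf.finestTopology {P | ∃ X, J.sheaves X ∧ P = (e.functor.obj X).obj}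

/-- The objects of `E` as presheaves on the site `C`. -/
abbrev toPresheaf : E ⥤ Cᵒᵖ ⥤ Type v := e.functor ⋙ sheafToPresheaf K (Type v)

/-- The object of `E` associated to a presheaf on the site `C`. -/
noncomputable abbrev ofPresheaf : (Cᵒᵖ ⥤ Type v) ⥤ E := presheafToSheaf K (Type v) ⋙ e.inverse

/-- `ofPresheaf` is left adjoint to `toPresheaf`. -/
noncomputable def presheafAdjunction : ofPresheaf e ⊣ toPresheaf e :=
  (sheafificationAdjunction K (Type v)).comp e.symm.toAdjunction

theorem isSheaf_toPresheaf {X : E} (hX : J.sheaves X) :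
    Presieve.IsSheaf (J.siteTopology e) ((toPresheaf e).obj X) :=
  Sheaf.sheaf_for_finestTopology _ ⟨X, hX, rfl⟩

theorem le_siteTopology : K ≤ J.siteTopology e := by
  refine Sheaf.le_finestTopology _ _ ?_
  rintro _ ⟨X, _, rfl⟩
  exact (isSheaf_iff_isSheaf_of_type _ _).1 (e.functor.obj X).property

/-- `ofPresheaf` preserves finite limits and the counit is invertible, so the image of the square
exhibits a pullback of `m`. -/
theorem denseMonos_ofPresheaf {V U : E} {m : V ⟶ U} (hm : J.denseMonos m) {F G : Cᵒᵖ ⥤ Type v}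
    {a : F ⟶ (toPresheaf e).obj V} {i : F ⟶ G} {x : G ⟶ (toPresheaf e).obj U}
    (sq : IsPullback a i ((toPresheaf e).map m) x) :
    J.denseMonos ((ofPresheaf e).map i) := by
  exact J.denseMonos_of_isPullback ((sq.map (ofPresheaf e)).paste_horiz
    (IsPullback.of_horiz_isIso ⟨((presheafAdjunction e).counit.naturality m).symm⟩)) hm

/-- Each pullback of the image sieve is itself an image sieve, hence a presheaf pullback of `m`. Its
associated mono in `E` is dense, and unique extension of maps into a `J`-sheaf along it transposes
to the sheaf condition. -/
theorem imageSieve_mem_siteTopology {V U : E} {m : V ⟶ U} (hm : J.denseMonos m) {c : C}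
    (x : ((toPresheaf e).obj U).obj (op c)) :
    Presheaf.imageSieve ((toPresheaf e).map m) x ∈ J.siteTopology e c := by
  have := hm.1
  refine Sheaf.mem_finestTopology_of_forall_isSheafFor ?_
  rintro _ ⟨X, hX, rfl⟩ d f
  rw [Presheaf.pullback_imageSieve, Presieve.isSheafFor_iff_yonedaSheafCondition]
  obtain ⟨a, sq⟩ := SieveOfSection.isPullback_imageSieve ((toPresheaf e).map m)
    (((toPresheaf e).obj U).map f.op x)
  have hb := hX _ (J.denseMonos_ofPresheaf e hm sq)
  rw [← Function.Bijective.of_comp_iff' ((presheafAdjunction e).homEquiv _ _).bijective,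
    ← Function.Bijective.of_comp_iff _ ((presheafAdjunction e).homEquiv _ _).symm.bijective] at hb
  intro φ
  refine (existsUnique_congr fun g ↦ ?_).1 ((Function.bijective_iff_existsUnique _).1 hb φ)
  dsimp only [Function.comp]
  rw [Adjunction.homEquiv_naturality_left, Equiv.apply_symm_apply]

/-- Local surjectivity is the covering property of image sieves; injectivity holds because `m` is
mono. -/
theorem W_toPresheaf_map {V U : E} {m : V ⟶ U} (hm : J.denseMonos m) :
    (J.siteTopology e).W ((toPresheaf e).map m) := by
  have := hm.1
  have : Presheaf.IsLocallySurjective (J.siteTopology e) ((toPresheaf e).map m) :=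
    ⟨fun x ↦ J.imageSieve_mem_siteTopology e hm x⟩
  have : Presheaf.IsLocallyInjective (J.siteTopology e) ((toPresheaf e).map m) :=
    Presheaf.isLocallyInjective_of_injective _ _ fun c ↦ (mono_iff_injective _).1 inferInstance
  exact (J.siteTopology e).W_of_isLocallyBijective _

theorem sheaves_of_isSheaf {X : E}
    (hX : Presheaf.IsSheaf (J.siteTopology e) ((toPresheaf e).obj X)) : J.sheaves X := by
  intro V U m hm
  have hb := J.W_toPresheaf_map e hm _ hX
  let hF : (toPresheaf e).FullyFaithful := .ofFullyFaithful _
  rw [← Function.Bijective.of_comp_iff' (hF.homEquiv (X := V) (Y := X)).bijective]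
  rw [← Function.Bijective.of_comp_iff _ (hF.homEquiv (X := U) (Y := X)).bijective] at hb
  convert hb using 1
  funext g
  exact (toPresheaf e).map_comp _ _

/-- The `J`-sheaves as sheaves on the site of `E`. -/
def toSiteSheaf : J.sheaves.FullSubcategory ⥤ Sheaf (J.siteTopology e) (Type v) :=
  ObjectProperty.lift _ (J.sheaves.ι ⋙ toPresheaf e) fun X ↦
    (isSheaf_iff_isSheaf_of_type _ _).2 (J.isSheaf_toPresheaf e X.property)

/-- The comparison with the sheaves on the site of `E` is fully faithful. -/
noncomputable def fullyFaithfulToSiteSheaf : (J.toSiteSheaf e).FullyFaithful :=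
  Functor.FullyFaithful.ofCompFaithful (G := sheafToPresheaf _ _)
    (Functor.FullyFaithful.ofFullyFaithful (J.sheaves.ι ⋙ toPresheaf e))

theorem essSurj_toSiteSheaf : (J.toSiteSheaf e).EssSurj where
  mem_essImage F := by
    have hF : Presheaf.IsSheaf K F.obj := by
      rw [isSheaf_iff_isSheaf_of_type]
      exact Presieve.isSheaf_of_le _ (J.le_siteTopology e)
        ((isSheaf_iff_isSheaf_of_type _ _).1 F.property)
    let i : (toPresheaf e).obj (e.inverse.obj ⟨F.obj, hF⟩) ≅ F.obj :=
      (sheafToPresheaf K (Type v)).mapIso (e.counitIso.app ⟨F.obj, hF⟩)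
    have h : J.sheaves (e.inverse.obj ⟨F.obj, hF⟩) :=
      J.sheaves_of_isSheaf e ((Presheaf.isSheaf_of_iso_iff i).2 F.property)
    exact ⟨⟨_, h⟩, ⟨(ObjectProperty.fullyFaithfulι _).preimageIso i⟩⟩

theorem isEquivalence_toSiteSheaf : (J.toSiteSheaf e).IsEquivalence where
  faithful := (J.fullyFaithfulToSiteSheaf e).faithful
  full := (J.fullyFaithfulToSiteSheaf e).full
  essSurj := J.essSurj_toSiteSheaf e

end

/-- Reflect by embedding `E` in presheaves, sheafifying for the site topology, and returning along
the equivalence with `J`-sheaves. -/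
theorem exists_lex_reflection :
    ∃ L : E ⥤ J.sheaves.FullSubcategory, Nonempty (L ⊣ J.sheaves.ι) ∧
      PreservesFiniteLimits L := by
  obtain ⟨C, _, K, ⟨e⟩⟩ := IsGrothendieckTopos.exists_equivalence (E := E)
  have := J.isEquivalence_toSiteSheaf e
  let a := presheafToSheaf (J.siteTopology e) (Type v)
  let Φ := (J.toSiteSheaf e).asEquivalence
  have : PreservesFiniteLimits (toPresheaf e) := comp_preservesFiniteLimits _ _
  have : PreservesFiniteLimits (toPresheaf e ⋙ a) := comp_preservesFiniteLimits _ _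
  refine ⟨(toPresheaf e ⋙ a) ⋙ Φ.inverse, ⟨?_⟩, comp_preservesFiniteLimits _ _⟩
  exact (sheafificationAdjunction (J.siteTopology e) (Type v)).restrictFullyFaithful
    (.ofFullyFaithful (toPresheaf e)) (J.fullyFaithfulToSiteSheaf e)
    ((Functor.rightUnitor _).symm ≪≫ Functor.isoWhiskerLeft (toPresheaf e ⋙ a) Φ.counitIso.symm)
    (Iso.refl _)

theorem exists_subtopos : ∃ S : Subtopos E, S.obj = J.sheaves := by
  obtain ⟨L, ⟨adj⟩, hL⟩ := J.exists_lex_reflection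
  have : J.sheaves.ι.IsRightAdjoint := adj.isRightAdjoint
  refine ⟨⟨J.sheaves, ⟨fun {X Y} i hX V U m hm ↦ ?_⟩, this, ?_⟩, rfl⟩
  · have hb := hX m hm
    rw [← Function.Bijective.of_comp_iff' (i.homToEquiv (Z := V)).bijective,
      ← Function.Bijective.of_comp_iff _ (i.homToEquiv (Z := U)).symm.bijective] at hb
    convert hb using 1
    funext g
    simp
  -- The chosen left adjoint is isomorphic to the constructed one.
  · exact preservesFiniteLimits_of_natIso
      (adj.leftAdjointUniq (Adjunction.ofIsRightAdjoint J.sheaves.ι))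

end LawvereTierneyTopology

/-! ### Inclusions of subtoposes and their sheaves -/

namespace GeometricMorphism

variable {E : Type u} [Category.{v} E] {E' : Type u₁} [Category.{v₁} E']
  (i : GeometricMorphism E' E)

/-- Under the adjunction this becomes composition with the isomorphism `i^* m`. -/
theorem bijective_comp_direct {V U : E} (m : V ⟶ U) [IsIso (i.inverse.map m)] (Y : E') :
    Function.Bijective (fun g : U ⟶ i.direct.obj Y ↦ m ≫ g) := by
  have h := (isIso_iff_coyoneda_map_bijective (i.inverse.map m)).1 inferInstance Y
  rw [← Function.Bijective.of_comp_iff' (i.adj.homEquiv V Y).bijective] at h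
  rw [← Function.Bijective.of_comp_iff _ (i.adj.homEquiv U Y).bijective]
  convert h using 1
  funext g
  exact (i.adj.homEquiv_naturality_left m g).symm

theorem bijective_comp_of_mem_essImage {V U : E} (m : V ⟶ U) [IsIso (i.inverse.map m)] {X : E}
    (hX : i.direct.essImage X) : Function.Bijective (fun g : U ⟶ X ↦ m ≫ g) := by
  obtain ⟨Y, ⟨f⟩⟩ := hX
  have h := i.bijective_comp_direct m Y
  rw [← Function.Bijective.of_comp_iff' (f.homToEquiv (Z := V)).bijective,
    ← Function.Bijective.of_comp_iff _ (f.homToEquiv (Z := U)).symm.bijective] at h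
  convert h using 1
  funext g
  simp

theorem injective_comp_of_mono_unit {V U : E} (m : V ⟶ U) [IsIso (i.inverse.map m)] (X : E)
    [Mono (i.adj.unit.app X)] : Function.Injective (fun g : U ⟶ X ↦ m ≫ g) := by
  intro g g' h
  rw [← cancel_mono (i.adj.unit.app X)]
  refine (i.bijective_comp_direct m _).1 ?_
  dsimp only at h ⊢
  rw [reassoc_of% h]

theorem isIso_inverse_map_of_isPullback {V U V' U' : E} {m' : V' ⟶ U'} {m : V ⟶ U} {a : V' ⟶ V}
    {h : U' ⟶ U} (sq : IsPullback a m' m h) [IsIso (i.inverse.map m)] :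
    IsIso (i.inverse.map m') := by
  have := i.lex
  exact (sq.map i.inverse).isIso_snd_of_isIso

/-- Both projections of the kernel pair restrict to the identity along the diagonal, so injectivity
makes them equal. -/
theorem mono_unit_of_injective [HasFiniteLimits E] (X : E)
    (h : Function.Injective (fun g : pullback (i.adj.unit.app X) (i.adj.unit.app X) ⟶ X ↦
      pullback.diagonal (i.adj.unit.app X) ≫ g)) : Mono (i.adj.unit.app X) := by
  have e : pullback.fst (i.adj.unit.app X) (i.adj.unit.app X) = pullback.snd _ _ := h (by simp)
  refine ⟨fun g g' hg ↦ ?_⟩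
  rw [← pullback.lift_fst g g' hg, e, pullback.lift_snd]

variable {i} (hi : i.IsInclusion)

include hi

theorem IsInclusion.isIso_inverse_map_unit (X : E) : IsIso (i.inverse.map (i.adj.unit.app X)) := by
  have := hi.full
  have := hi.faithful
  infer_instance

theorem IsInclusion.isIso_unit (X : E) (hX : i.direct.essImage X) : IsIso (i.adj.unit.app X) := by
  have := hi.full
  have := hi.faithful
  exact i.adj.isIso_unit_app_of_iso hX.getIso.symm

variable [HasFiniteLimits E]

/-- `i^*` inverts the unit, hence its pullback, the second projection of the kernel pair, and the
diagonal is a section of that projection. -/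
theorem IsInclusion.isIso_inverse_map_diagonal (X : E) :
    IsIso (i.inverse.map (pullback.diagonal (i.adj.unit.app X))) := by
  have := hi.isIso_inverse_map_unit X
  have := i.isIso_inverse_map_of_isPullback (IsPullback.of_hasPullback (i.adj.unit.app X) (i.adj.unit.app X))
  have h : i.inverse.map (pullback.diagonal (i.adj.unit.app X)) ≫
      i.inverse.map (pullback.snd _ _) = 𝟙 _ := by
    rw [← Functor.map_comp, pullback.diagonal_snd, CategoryTheory.Functor.map_id]
  exact IsIso.of_isIso_fac_right h

/-- The objects in the image of an inclusion are those that are local for the monomorphisms that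
are inverted by the inverse image. -/
theorem IsInclusion.mem_essImage (X : E)
    (h : ∀ ⦃V U : E⦄ (m : V ⟶ U), Mono m → IsIso (i.inverse.map m) →
      Function.Bijective (fun g : U ⟶ X ↦ m ≫ g)) : i.direct.essImage X := by
  have hη := hi.isIso_inverse_map_unit X
  -- Locality for the diagonal makes the unit mono, so locality for monos applies to the unit
  -- itself. Extending `𝟙 X` along it gives the inverse.
  have := i.mono_unit_of_injective X (h _ inferInstance (hi.isIso_inverse_map_diagonal X)).1
  obtain ⟨r, hr⟩ := (h (i.adj.unit.app X) this hη).2 (𝟙 X)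
  dsimp only at hr
  refine ⟨i.inverse.obj X, ⟨⟨r, i.adj.unit.app X, ?_, hr⟩⟩⟩
  refine (i.bijective_comp_direct (i.adj.unit.app X) (i.inverse.obj X)).1 ?_
  dsimp only
  rw [reassoc_of% hr]
  exact (Category.comp_id _).symm

end GeometricMorphism

namespace Subtopos

variable {E : Type u} [Category.{v} E] (S : Subtopos E)

theorem isInclusion_inclusion : S.inclusion.IsInclusion where
  full := inferInstanceAs S.obj.ι.Full
  faithful := inferInstanceAs S.obj.ι.Faithful

theorem essImage_direct_inclusion : S.inclusion.direct.essImage = S.obj := by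
  have := S.closedUnderIso
  ext X
  refine ⟨fun ⟨Y, ⟨f⟩⟩ ↦ S.obj.prop_of_iso f Y.property, fun hX ↦ ⟨⟨X, hX⟩, ⟨Iso.refl _⟩⟩⟩

end Subtopos

/-! ### Pure and dense inclusions versus the sheaf subtopos -/

namespace IsGrothendieckTopos

variable {E : Type u} [Category.{v} E] [IsGrothendieckTopos E] {E' : Type u₁} [Category.{v₁} E']
  {i : GeometricMorphism E' E} {A : ObjectProperty E} {J : LawvereTierneyTopology E}

/-- Pullbacks of `m` are still inverted by `i^*`, and purity puts each `X` in `A` in the image of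
`i_*`, which is local for them. -/
theorem pureMonos_of_isPure (h : i.IsPure A) {V U : E} (m : V ⟶ U) [Mono m]
    [IsIso (i.inverse.map m)] : pureMonos A m := by
  rw [pureMonos_eq]
  refine ⟨inferInstance, fun X hX W k ↦ ?_⟩
  have := i.isIso_inverse_map_of_isPullback (IsPullback.of_hasPullback k m).flip
  have := h X hX
  exact i.bijective_comp_of_mem_essImage _ ⟨_, ⟨(asIso (i.adj.unit.app X)).symm⟩⟩

theorem denseMonos_of_isDense (h : i.IsDense A) {V U : E} (m : V ⟶ U) [Mono m]
    [IsIso (i.inverse.map m)] : _root_.denseMonos A m := by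
  rw [denseMonos_eq]
  refine ⟨inferInstance, fun X hX W k ↦ ?_⟩
  have := i.isIso_inverse_map_of_isPullback (IsPullback.of_hasPullback k m).flip
  have := h X hX
  exact i.injective_comp_of_mono_unit _ X

theorem restrictionMonos.self {Q : ∀ ⦃α β : Type v⦄, (α → β) → Prop} (hQ : IsRestrictionClass Q)
    {V U : E} {m : V ⟶ U} (hm : restrictionMonos Q A m) {X : E} (hX : A X) :
    Q (fun g : U ⟶ X ↦ m ≫ g) :=
  (restriction_iff hQ (IsPullback.of_vert_isIso ⟨by simp⟩ : IsPullback m (𝟙 V) (𝟙 U) m) X).1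
    (hm.2 X hX _)

theorem isPure_iff (hJ : J.denseMonos = pureMonos A) (hi : i.IsInclusion) :
    i.IsPure A ↔ J.sheaves ≤ i.direct.essImage := by
  refine ⟨fun h X hX ↦ hi.mem_essImage X fun V U m _ _ ↦ hX m ?_, fun h X hX ↦ ?_⟩
  · rw [hJ]
    exact pureMonos_of_isPure h m
  -- Every `X` in `A` is a `J`-sheaf: take `W = U` in the restriction condition.
  · refine hi.isIso_unit X (h X fun V U m hm ↦ ?_)
    rw [hJ, pureMonos_eq] at hm
    exact hm.self .bijective hX

theorem isDense_iff (hJ : J.denseMonos = _root_.denseMonos A) (hi : i.IsInclusion) :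
    i.IsDense A ↔ J.sheaves ≤ i.direct.essImage := by
  refine ⟨fun h X hX ↦ hi.mem_essImage X fun V U m _ _ ↦ hX m ?_, fun h X hX ↦ ?_⟩
  · rw [hJ]
    exact denseMonos_of_isDense h m
  · refine i.mono_unit_of_injective X ?_
    have := hi.isIso_inverse_map_diagonal X
    -- Here `X` need not be a sheaf, so density of the diagonal is tested on the `J`-sheaves, which
    -- lie in the image of `i_*`.
    have hd := J.denseMonos_of_sheaves (pullback.diagonal (i.adj.unit.app X))
      fun F hF ↦ (i.bijective_comp_of_mem_essImage _ (h F hF)).1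
    rw [hJ, denseMonos_eq] at hd
    exact hd.self .injective hX

theorem exists_least_isPure (hJ : J.denseMonos = pureMonos A) :
    ∃ S : Subtopos E, S.obj = J.sheaves ∧
      IsLeast {S' : Subtopos E | S'.inclusion.IsPure A} S ∧
      (∀ S' : Subtopos E, S'.inclusion.IsPure A ↔ S ≤ S') := by
  obtain ⟨S, hS⟩ := J.exists_subtopos
  have key (S' : Subtopos E) : S'.inclusion.IsPure A ↔ S ≤ S' := by
    rw [isPure_iff hJ S'.isInclusion_inclusion, S'.essImage_direct_inclusion, ← hS]
    rfl
  exact ⟨S, hS, ⟨(key S).2 le_rfl, fun S' ↦ (key S').1⟩, key⟩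

theorem exists_least_isDense (hJ : J.denseMonos = _root_.denseMonos A) :
    ∃ S : Subtopos E, S.obj = J.sheaves ∧
      IsLeast {S' : Subtopos E | S'.inclusion.IsDense A} S ∧
      (∀ S' : Subtopos E, S'.inclusion.IsDense A ↔ S ≤ S') := by
  obtain ⟨S, hS⟩ := J.exists_subtopos
  have key (S' : Subtopos E) : S'.inclusion.IsDense A ↔ S ≤ S' := by
    rw [isDense_iff hJ S'.isInclusion_inclusion, S'.essImage_direct_inclusion, ← hS]
    rfl
  exact ⟨S, hS, ⟨(key S).2 le_rfl, fun S' ↦ (key S').1⟩, key⟩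

end IsGrothendieckTopos

/-! ### Density and purity over a base topos -/

namespace GeometricMorphism

variable {E : Type u} [Category.{v} E] {F : Type u₁} [Category.{v₁} F]
  {T : Type u₂} [Category.{v₂} T] (ρ : GeometricMorphism F E) (e : GeometricMorphism E T)

theorem isDense_constants_iff : ρ.IsDense e.constants ↔ ρ.IsDenseOver e :=
  ⟨fun h _ ↦ h _ (ObjectProperty.strictMap_obj _ _ trivial), fun h _ ⟨_, _⟩ ↦ h _⟩

theorem isPure_constantOmega_iff [HasSubobjectClassifier T] :
    ρ.IsPure e.constantOmega ↔ ρ.IsPureOver e :=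
  ⟨fun h ↦ h _ ((ObjectProperty.singleton_iff _ _).2 rfl), fun h X hX ↦ by
    obtain rfl := (ObjectProperty.singleton_iff _ _).1 hX
    exact h⟩

end GeometricMorphism

open IsGrothendieckTopos in
theorem mainTheorem2 {E : Type u} [Category.{v} E] [IsGrothendieckTopos E] :
    (∀ A : ObjectProperty E,
      -- the pure monomorphisms form a topology, with the smallest pure subtopos as its sheaves
      (∃! J : LawvereTierneyTopology E, J.denseMonos = pureMonos A) ∧
      (∀ J : LawvereTierneyTopology E, J.denseMonos = pureMonos A →
        ∃ S : Subtopos E, S.obj = J.sheaves ∧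
          IsLeast {S' : Subtopos E | S'.inclusion.IsPure A} S ∧
          (∀ S' : Subtopos E, S'.inclusion.IsPure A ↔ S ≤ S') ∧
          (∀ {E' : Type u₁} [Category.{v₁} E'] (i : GeometricMorphism E' E), i.IsInclusion →
            (i.IsPure A ↔ S.obj ≤ i.direct.essImage))) ∧
      -- the dense monomorphisms form a topology, with the smallest dense subtopos as its sheaves
      (∃! J : LawvereTierneyTopology E, J.denseMonos = denseMonos A) ∧
      (∀ J : LawvereTierneyTopology E, J.denseMonos = denseMonos A →
        ∃ S : Subtopos E, S.obj = J.sheaves ∧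
          IsLeast {S' : Subtopos E | S'.inclusion.IsDense A} S ∧
          (∀ S' : Subtopos E, S'.inclusion.IsDense A ↔ S ≤ S') ∧
          (∀ {E' : Type u₁} [Category.{v₁} E'] (i : GeometricMorphism E' E), i.IsInclusion →
            (i.IsDense A ↔ S.obj ≤ i.direct.essImage)))) ∧
    -- special cases: the smallest dense and the smallest pure subtopos over a base topos
    (∀ {T : Type u₂} [Category.{v} T] [IsGrothendieckTopos T] (e : GeometricMorphism E T),
      (∃ (J : LawvereTierneyTopology E) (S : Subtopos E),
        J.denseMonos = denseMonos e.constants ∧ S.obj = J.sheaves ∧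
        IsLeast {S' : Subtopos E | S'.inclusion.IsDenseOver e} S ∧
        (∀ S' : Subtopos E, S'.inclusion.IsDenseOver e ↔ S ≤ S')) ∧
      (∃ (J : LawvereTierneyTopology E) (S : Subtopos E),
        J.denseMonos = pureMonos e.constantOmega ∧ S.obj = J.sheaves ∧
        IsLeast {S' : Subtopos E | S'.inclusion.IsPureOver e} S ∧
        (∀ S' : Subtopos E, S'.inclusion.IsPureOver e ↔ S ≤ S'))) := by

  refine ⟨fun A ↦ ⟨?_, fun J hJ ↦ ?_, ?_, fun J hJ ↦ ?_⟩, fun e ↦ ⟨?_, ?_⟩⟩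
  · obtain ⟨J, hJ⟩ := exists_denseMonos_eq_pureMonos A
    exact ⟨J, hJ, fun J' hJ' ↦ LawvereTierneyTopology.denseMonos_injective (hJ'.trans hJ.symm)⟩
  · obtain ⟨S, hS, hl, h⟩ := exists_least_isPure hJ
    exact ⟨S, hS, hl, h, fun i hi ↦ hS ▸ isPure_iff hJ hi⟩
  · obtain ⟨J, hJ⟩ := exists_denseMonos_eq_denseMonos A
    exact ⟨J, hJ, fun J' hJ' ↦ LawvereTierneyTopology.denseMonos_injective (hJ'.trans hJ.symm)⟩
  · obtain ⟨S, hS, hl, h⟩ := exists_least_isDense hJ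
    exact ⟨S, hS, hl, h, fun i hi ↦ hS ▸ isDense_iff hJ hi⟩
  · obtain ⟨J, hJ⟩ := exists_denseMonos_eq_denseMonos e.constants
    obtain ⟨S, hS, hl, h⟩ := exists_least_isDense hJ
    simp only [GeometricMorphism.isDense_constants_iff] at hl h
    exact ⟨J, S, hJ, hS, hl, h⟩
  · obtain ⟨J, hJ⟩ := exists_denseMonos_eq_pureMonos e.constantOmega
    obtain ⟨S, hS, hl, h⟩ := exists_least_isPure hJ
    simp only [GeometricMorphism.isPure_constantOmega_iff] at hl h
    exact ⟨J, S, hJ, hS, hl, h⟩
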